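/- **Conventions.** All objects depend on a security parameter $\lambda$; PPT means probabilistic (strict) polynomial time; a function $\nu:\mathbb N\to[0,\infty)$ is negligible if for every $c\ge 1$ there is $N\geq 1$ with $\nu(n)<n^{-c}$ for all $n\ge N$; "with overwhelming probability" means with probability at least $1-\nu(\lambda)$ for a negligible $\nu$. *Public key encryption.* A scheme $\mathcal E$ has a plaintext space $\mathcal M$, a ciphertext space $\mathcal C$ and PPT algorithms $\mathrm{KeyGen}$ (which first samples a secret key $sk$ and then, from $sk$, a public key $pk$), $\mathrm{Enc}(pk,m)\in\mathcal C$, $\mathrm{Dec}(sk,c)\in\mathcal M$, such that for all keys $(sk,pk)$ output by $\mathrm{KeyGen}(1^\lambda)$ and all $m\in\mathcal M$, $\mathrm{Dec}(sk,\mathrm{Enc}(pk,m))=m$ with overwhelming probability. Given public information $z$ sampled together with the keys, $\mathcal E$ is IND-CPA secure given $z$ if every PPT adversary, which receives $z$, chooses $m_0,m_1\in\mathcal M$, receives $\mathrm{Enc}(pk,m_b)$ for a uniform bit $b$ and outputs a bit $b'$, satisfies: $|\Pr[b'=b]-\Pr[b'\ne b]|$ is negligible. $\mathcal E$ is secure if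 it is IND-CPA secure given $z=pk$. *FHE.* A homomorphic encryption scheme $\mathcal H$ is such a scheme with plaintexts in $\{0,1\}^{m(\lambda)}$, whose public key includes an evaluation key $evk$, with a PPT algorithm $\mathrm{Eval}(evk,C,c_1,\dots,c_\ell)\in\mathcal C$ that is compact (output of size at most $s(\lambda)$ for a polynomial $s$) and correct: for every polynomial $p$, for evaluable boolean circuits $C:\mathcal M^\ell\to\mathcal M$ with $\ell$ plus the size of $C$ at most $p(\lambda)$, all keys and all $m_1,\dots,m_\ell\in\mathcal M$, $\mathrm{Dec}(sk,\mathrm{Eval}(evk,C,\mathrm{Enc}(pk,m_1),\dots,\mathrm{Enc}(pk,m_\ell)))=C(m_1,\dots,m_\ell)$ with overwhelming probability. It is fully homomorphic (FHE) if all boolean circuits $C:\mathcal M^\ell\to\mathcal M$, $\ell\in\mathbb N$, are evaluable. *Bridges.* A bridge $f:\mathcal E_1\to\mathcal E_2$ consists of (1) a deterministic polynomial time map $\iota_f:\mathcal M_1\to\mathcal M_2$; (2) a PPT key generation in three stages: $(sk_1,pk_1)\leftarrow\mathrm{KeyGen}_1(1^\lambda)$; then, from $sk_1$, a secret key $sk_2$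 of level $\lambda$ for $\mathcal E_2$ (possibly with a private state that is handed to the last stage), and $pk_2$ from $sk_2$ by the second part of $\mathrm{KeyGen}_2$; finally, from $(sk_1,pk_1,sk_2,pk_2)$ (and the state), a bridge key $bk_f$; (3) a PPT algorithm $f(bk_f,c_1)$ from ciphertexts of $\mathcal E_1$ to ciphertexts of $\mathcal E_2$, such that for all $m\in\mathcal M_1$, $\mathrm{Dec}_2(sk_2,f(bk_f,\mathrm{Enc}_1(pk_1,m)))=\iota_f(m)$ with overwhelming probability over all the algorithms involved. The bridge is secure if $\mathcal E_1$ is IND-CPA secure given $(pk_1,pk_2,bk_f)$. *Composition.* For $f:\mathcal E_1\to\mathcal E_2$ and $g:\mathcal E_2\to\mathcal E_3$, $g\circ f$ has the map $\iota_g\circ\iota_f$; its key generation runs that of $f$ to get $(sk_1,pk_1,sk_2,pk_2,bk_f)$, then the second and third stages of that of $g$ on $(sk_2,pk_2)$ to get $(sk_3,pk_3,bk_g)$, and outputs the bridge key $(bk_f,pk_2,bk_g)$; its algorithm sends $c_1$ to $g(bk_g,f(bk_f,c_1))$. *Gentry-type bridges.* Let $\mathcal E$ be a scheme whose secret keys and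 ciphertexts are represented, in polynomial time, as bit strings of polynomial lengths $e(\lambda)$ and $n(\lambda)$, and let $0_{\mathcal H},1_{\mathcal H}$ be plaintexts of $\mathcal H$ that are computable in polynomial time. A bridge $g:\mathcal E\to\mathcal H$ is of Gentry type if the keys of $\mathcal H$ are generated by $\mathrm{KeyGen}_{\mathcal H}$ independently of those of $\mathcal E$; the bridge key is the vector of encryptions under $pk_{\mathcal H}$ of the bits of $sk_{\mathcal E}$ (as $0_{\mathcal H},1_{\mathcal H}$), together with the public key of $\mathcal H$; and $g(bk,c)$ encrypts the bits of $c$ under $pk_{\mathcal H}$ and applies $\mathrm{Eval}$ to a boolean circuit $\mathcal M_{\mathcal H}^{e+n}\to\mathcal M_{\mathcal H}$, computable from $1^\lambda$ in polynomial time, that computes $\iota_g\circ\mathrm{Dec}_{\mathcal E}$ (with $\mathrm{Dec}_{\mathcal E}$ deterministic) on the bits of the secret key and of the ciphertext. **Theorem 4.** Let $f:\mathcal E_1\to\mathcal E_2$ be a secure bridge, let $\mathcal H$ be a secure FHE scheme, and let $g:\mathcal E_2\to\mathcal H$ be a secure Gentry-type bridge. Then $g\circ f$ is a bridge from $\mathcal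 E_1$ to $\mathcal H$, and it is secure. -/

import Mathlib

noncomputable section

namespace Crypto

/-! ### Data, programs and running time -/

/-- Binary trees, the data on which algorithms operate. -/
inductive Data : Type where
  | nil : Data
  | node : Data → Data → Data

namespace Data

/-- Number of internal nodes; a tree of size `s` is written with `2 * s + 1` bits. -/
def size : Data → ℕ
  | nil => 0
  | node a b => size a + size b + 1

/-- First component of a pair. -/
def fst : Data → Data
  | nil => nil
  | node a _ => a

/-- Second component of a pair. -/
def snd : Data → Data
  | nil => nil
  | node _ b => b

/-- The unary representation `1ⁿ`. -/
def unary : ℕ → Data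
  | 0 => nil
  | n + 1 => node nil (unary n)

def ofBit : Bool → Data
  | false => nil
  | true => node nil nil

/-- `nil` is the bit `0`, everything else is the bit `1`. -/
def toBit : Data → Bool
  | nil => false
  | node _ _ => true

def ofList : List Data → Data
  | [] => nil
  | a :: l => node a (ofList l)

def toList : Data → List Data
  | nil => []
  | node a l => a :: toList l

/-- A bit string as a datum. -/
def ofBits (l : List Bool) : Data := ofList (l.map ofBit)

/-- The bit string that a datum stands for (inverse to `ofBits`). -/
def toBits (d : Data) : List Bool := d.toList.map toBit

/-- Concatenation of two lists that are given as data. -/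
def append : Data → Data → Data
  | nil, y => y
  | node a l, y => node a (append l y)

end Data

open Data

/-- Programs of a small sequential language on binary trees with a fair coin. -/
inductive Prog : Type where
  /-- return the input -/
  | id : Prog
  /-- return `nil` -/
  | nil : Prog
  /-- first component of the input -/
  | fst : Prog
  /-- second component of the input -/
  | snd : Prog
  /-- a fair coin toss -/
  | coin : Prog
  /-- run both programs on the input and pair the results -/
  | pair : Prog → Prog → Prog
  /-- `comp p q` runs `q` first and then `p` on the result -/
  | comp : Prog → Prog → Prog
  /-- `cond c p q` runs `c` on the input; then, on the same input, `p` if the result is the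
  bit `1`, and `q` otherwise -/
  | cond : Prog → Prog → Prog → Prog
  /-- on input `node a y`, run the program `a.size` times in a row, starting from `y` -/
  | iter : Prog → Prog

/-- Run `F` `k` times in a row, adding up the costs. -/
def loop (F : Data → PMF (Data × ℕ)) : ℕ → Data → PMF (Data × ℕ)
  | 0, y => pure (y, 0)
  | k + 1, y => do
    let r ← F y
    let s ← loop F k r.1
    pure (s.1, r.2 + s.2)

/-- The joint distribution of the result of a program and of the time it takes. Every instruction
is charged `1` plus the size of the datum it works on (so that copying is paid for), in addition to
the time of its parts. Up to a polynomial this is the running time of a probabilistic Turing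
machine: an instruction takes time linear in its charge on a multi-tape machine; conversely,
a program can write down the value of a polynomial in unary and iterate the transition function
of a machine that often. -/
def Prog.run : Prog → Data → PMF (Data × ℕ)
  | .id, x => pure (x, 1 + x.size)
  | .nil, x => pure (Data.nil, 1 + x.size)
  | .fst, x => pure (x.fst, 1 + x.size)
  | .snd, x => pure (x.snd, 1 + x.size)
  | .coin, x => do
    let b ← PMF.uniformOfFintype Bool
    pure (ofBit b, 1 + x.size)
  | .pair p q, x => do
    let r ← p.run x
    let s ← q.run x
    pure (node r.1 s.1, 1 + x.size + r.2 + s.2)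
  | .comp p q, x => do
    let r ← q.run x
    let s ← p.run r.1
    pure (s.1, 1 + x.size + r.2 + s.2)
  | .cond c p q, x => do
    let r ← c.run x
    let s ← if r.1.toBit then p.run x else q.run x
    pure (s.1, 1 + x.size + r.2 + s.2)
  | .iter p, x => do
    let r ← loop p.run x.fst.size x.snd
    pure (r.1, 1 + x.size + r.2)

/-- The program tosses no coins. -/
def Prog.Deterministic : Prog → Prop
  | .coin => False
  | .pair p q => p.Deterministic ∧ q.Deterministic
  | .comp p q => p.Deterministic ∧ q.Deterministic
  | .cond c p q => c.Deterministic ∧ p.Deterministic ∧ q.Deterministic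
  | .iter p => p.Deterministic
  | _ => True

/-- The program `P`, on input `(1ⁿ, x)`, has output distribution `A n x`, and for some polynomial
`p` it always (for all inputs and all coin tosses) stops after at most `p (n + |x|)` steps. -/
def Prog.Computes (P : Prog) (A : ℕ → Data → PMF Data) : Prop :=
  (∀ n x, (P.run (node (unary n) x)).map Prod.fst = A n x) ∧
  ∃ p : Polynomial ℕ, ∀ n x, ∀ r ∈ (P.run (node (unary n) x)).support, r.2 ≤ p.eval (n + x.size)

/-- Probabilistic polynomial time algorithms; the first argument is the security parameter. -/
def IsPPT (A : ℕ → Data → PMF Data) : Prop :=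
  ∃ P : Prog, P.Computes A

/-- Functions computable by a deterministic polynomial time algorithm. -/
def IsPolyTime (F : ℕ → Data → Data) : Prop :=
  ∃ P : Prog, P.Deterministic ∧ P.Computes fun n x => pure (F n x)

/-- Negligible functions `ℕ → [0, ∞)`. -/
def Negligible (ν : ℕ → ℝ) : Prop :=
  (∀ n, 0 ≤ ν n) ∧ ∀ c : ℕ, 0 < c → ∃ N : ℕ, 0 < N ∧ ∀ n ≥ N, ν n < 1 / (n : ℝ) ^ c

/-- The probability of the outcome `a`. -/
def prob {α : Type} (p : PMF α) (a : α) : ℝ := (p a).toReal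

/-! ### Public key encryption -/

/-- Correct public key encryption schemes. All objects depend on the security parameter `n`. -/
structure PKE where
  /-- plaintext space -/
  msg : ℕ → Set Data
  /-- ciphertext space -/
  ct : ℕ → Set Data
  /-- first part of the key generation: the secret key -/
  skGen : ℕ → PMF Data
  /-- second part of the key generation: the public key, from the secret key -/
  pkGen : ℕ → Data → PMF Data
  /-- encryption, from the public key and a message -/
  enc : ℕ → Data → Data → PMF Data
  /-- decryption, from the secret key and a ciphertext -/
  dec : ℕ → Data → Data → PMF Data
  skGen_ppt : IsPPT fun n _ => skGen n
  pkGen_ppt : IsPPT pkGen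
  enc_ppt : IsPPT fun n x => enc n x.fst x.snd
  dec_ppt : IsPPT fun n x => dec n x.fst x.snd
  enc_mem : ∀ n, ∀ sk ∈ (skGen n).support, ∀ pk ∈ (pkGen n sk).support, ∀ m ∈ msg n,
    ∀ c ∈ (enc n pk m).support, c ∈ ct n
  dec_mem : ∀ n, ∀ sk ∈ (skGen n).support, ∀ c ∈ ct n, ∀ m ∈ (dec n sk c).support, m ∈ msg n
  /-- correct decryption, with overwhelming probability, for all keys and messages -/
  correct : ∃ ν, Negligible ν ∧ ∀ n, ∀ sk ∈ (skGen n).support, ∀ pk ∈ (pkGen n sk).support,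
    ∀ m ∈ msg n, 1 - ν n ≤ prob (do let c ← enc n pk m; dec n sk c) m

/-- A two-stage chosen plaintext adversary. -/
structure Adversary where
  /-- from the public information to `(m₀, m₁, state)` -/
  choose : ℕ → Data → PMF Data
  /-- from `(state, challenge ciphertext)` to the guess -/
  guess : ℕ → Data → PMF Data
  choose_ppt : IsPPT choose
  guess_ppt : IsPPT guess

/-- The adversary chooses its messages from the plaintext space `M`. -/
def Adversary.ValidFor (A : Adversary) (M : ℕ → Set Data) : Prop :=
  ∀ n z, ∀ r ∈ (A.choose n z).support, r.fst ∈ M n ∧ r.snd.fst ∈ M n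

/-- The IND-CPA experiment for `E`, when the adversary is given the public information `z` and
`(pk, z)` is sampled from `K n`. -/
def PKE.experiment (E : PKE) (K : ℕ → PMF (Data × Data)) (A : Adversary) (n : ℕ) : PMF Bool := do
  let k ← K n
  let r ← A.choose n k.2
  let b ← PMF.uniformOfFintype Bool
  let c ← E.enc n k.1 (if b then r.snd.fst else r.fst)
  let b' ← A.guess n (node r.snd.snd c)
  pure (b'.toBit == b)

/-- IND-CPA security of `E` when `(pk, z)` is sampled from `K n` and `z` is made public. -/
def PKE.SecureGiven (E : PKE) (K : ℕ → PMF (Data × Data)) : Prop :=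
  ∀ A : Adversary, A.ValidFor E.msg →
    Negligible fun n => |prob (E.experiment K A n) true - prob (E.experiment K A n) false|

/-- IND-CPA security. -/
def PKE.Secure (E : PKE) : Prop :=
  E.SecureGiven fun n => do
    let sk ← E.skGen n
    let pk ← E.pkGen n sk
    pure (pk, pk)

/-- A list of independent encryptions of the messages in a list. -/
def PKE.encList (E : PKE) (n : ℕ) (pk : Data) : List Data → PMF Data
  | [] => pure nil
  | m :: ms => do
    let c ← E.enc n pk m
    let cs ← E.encList n pk ms
    pure (node c cs)

/-! ### Boolean circuits and homomorphic encryption -/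

/-- Gates; the arguments are numbers of wires. -/
inductive Gate : Type where
  | const : Bool → Gate
  | xor : ℕ → ℕ → Gate
  | and : ℕ → ℕ → Gate

def Gate.encode : Gate → Data
  | .const b => node (unary 0) (ofBit b)
  | .xor i j => node (unary 1) (node (unary i) (unary j))
  | .and i j => node (unary 2) (node (unary i) (unary j))

/-- The value of a gate, from the list of the values of the wires so far. -/
def Gate.value (w : List Bool) : Gate → Bool
  | .const b => b
  | .xor i j => Bool.xor (w.getD i false) (w.getD j false)
  | .and i j => (w.getD i false) && (w.getD j false)

/-- Boolean circuits: the wires `0, 1, …` are the inputs, followed by the gates in their order;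
`outs` lists the output wires. -/
structure Circuit where
  gates : List Gate
  outs : List ℕ

namespace Circuit

/-- The representation of a circuit as a datum. -/
def encode (C : Circuit) : Data :=
  node (ofList (C.gates.map Gate.encode)) (ofList (C.outs.map unary))

/-- The function on bit strings that a circuit computes. -/
def eval (C : Circuit) (x : List Bool) : List Bool :=
  let w := C.gates.foldl (fun w G => w ++ [G.value w]) x
  C.outs.map fun i => w.getD i false

/-- The value of a circuit at a tuple of messages that are bit strings. -/
def apply (C : Circuit) (ms : List Data) : Data := ofBits (C.eval (ms.flatMap toBits))

/-- The circuit defines a map `M ^ ℓ → M`. -/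
def IsMap (C : Circuit) (M : Set Data) (ℓ : ℕ) : Prop :=
  ∀ ms : List Data, ms.length = ℓ → (∀ m ∈ ms, m ∈ M) → C.apply ms ∈ M

end Circuit

/-- Public key homomorphic encryption schemes. The public key of the underlying encryption scheme
includes the evaluation key. -/
structure HE extends PKE where
  /-- the plaintexts are bit strings of length `msgLen n` -/
  msgLen : ℕ → ℕ
  msg_bits : ∀ n, ∀ m ∈ msg n, ∃ l : List Bool, l.length = msgLen n ∧ m = ofBits l
  /-- the evaluable circuits `M ^ ℓ → M` -/
  evaluable : ℕ → ℕ → Set Circuit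
  evaluable_isMap : ∀ n ℓ, ∀ C ∈ evaluable n ℓ, C.IsMap (msg n) ℓ
  /-- evaluation, from the evaluation key, a circuit, and a list of ciphertexts -/
  eval : ℕ → Data → Data → Data → PMF Data
  eval_ppt : IsPPT fun n x => eval n x.fst x.snd.fst x.snd.snd
  eval_mem : ∀ n, ∀ sk ∈ (skGen n).support, ∀ pk ∈ (pkGen n sk).support,
    ∀ ℓ, ∀ C ∈ evaluable n ℓ, ∀ cs : List Data, cs.length = ℓ → (∀ c ∈ cs, c ∈ ct n) →
      ∀ c ∈ (eval n pk C.encode (ofList cs)).support, c ∈ ct n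
  /-- compactness: the size of the output is bounded independently of the circuit -/
  compact : ∃ s : Polynomial ℕ, ∀ n, ∀ sk ∈ (skGen n).support, ∀ pk ∈ (pkGen n sk).support,
    ∀ ℓ, ∀ C ∈ evaluable n ℓ, ∀ cs : List Data, cs.length = ℓ → (∀ c ∈ cs, c ∈ ct n) →
      ∀ c ∈ (eval n pk C.encode (ofList cs)).support, c.size ≤ s.eval n
  /-- correct evaluation of circuits of polynomial size, with overwhelming probability -/
  eval_correct : ∀ p : Polynomial ℕ, ∃ ν, Negligible ν ∧ ∀ n, ∀ sk ∈ (skGen n).support,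
    ∀ pk ∈ (pkGen n sk).support, ∀ ℓ, ∀ C ∈ evaluable n ℓ, ℓ + C.encode.size ≤ p.eval n →
      ∀ ms : List Data, ms.length = ℓ → (∀ m ∈ ms, m ∈ msg n) →
        1 - ν n ≤ prob (do
          let cs ← toPKE.encList n pk ms
          let c ← eval n pk C.encode cs
          dec n sk c) (C.apply ms)

/-- Fully homomorphic: all boolean circuits `M ^ ℓ → M` are evaluable. -/
def HE.IsFHE (H : HE) : Prop :=
  ∀ n ℓ, ∀ C : Circuit, C.IsMap (H.msg n) ℓ → C ∈ H.evaluable n ℓ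

/-! ### Bridges -/

/-- The output of the key generation of a bridge. -/
structure BridgeKeys where
  sk₁ : Data
  pk₁ : Data
  sk₂ : Data
  pk₂ : Data
  bk : Data

/-- The constituents of a bridge, without the requirements on them. -/
structure PreBridge (E₁ E₂ : PKE) where
  /-- the map of plaintexts -/
  ι : ℕ → Data → Data
  /-- second stage of the key generation: from `sk₁` to a pair of `sk₂` and a private state, which
  is handed over to the third stage -/
  skStage : ℕ → Data → PMF Data
  /-- third stage: from `sk₁, pk₁, sk₂, pk₂` and the state to the bridge key -/
  bkStage : ℕ → Data → Data → Data → Data → Data → PMF Data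
  /-- from the bridge key and a ciphertext of `E₁` to a ciphertext of `E₂` -/
  apply : ℕ → Data → Data → PMF Data

namespace PreBridge

variable {E₁ E₂ E₃ : PKE}

/-- The key generation of a bridge. -/
def keyGen (f : PreBridge E₁ E₂) (n : ℕ) : PMF BridgeKeys := do
  let sk₁ ← E₁.skGen n
  let pk₁ ← E₁.pkGen n sk₁
  let s ← f.skStage n sk₁
  let pk₂ ← E₂.pkGen n s.fst
  let bk ← f.bkStage n sk₁ pk₁ s.fst pk₂ s.snd
  pure ⟨sk₁, pk₁, s.fst, pk₂, bk⟩

/-- The requirements on a bridge. -/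
structure IsBridge (f : PreBridge E₁ E₂) : Prop where
  ι_polyTime : IsPolyTime f.ι
  ι_mem : ∀ n, ∀ m ∈ E₁.msg n, f.ι n m ∈ E₂.msg n
  skStage_ppt : IsPPT f.skStage
  /-- the second stage finds a secret key of level `n` for `E₂` -/
  skStage_mem : ∀ n, ∀ sk₁ ∈ (E₁.skGen n).support, ∀ s ∈ (f.skStage n sk₁).support,
    s.fst ∈ (E₂.skGen n).support
  bkStage_ppt : IsPPT fun n x =>
    f.bkStage n x.fst x.snd.fst x.snd.snd.fst x.snd.snd.snd.fst x.snd.snd.snd.snd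
  apply_ppt : IsPPT fun n x => f.apply n x.fst x.snd
  apply_mem : ∀ n, ∀ k ∈ (f.keyGen n).support, ∀ c ∈ E₁.ct n,
    ∀ c' ∈ (f.apply n k.bk c).support, c' ∈ E₂.ct n
  /-- correctness on fresh encryptions, with overwhelming probability -/
  correct : ∃ ν, Negligible ν ∧ ∀ n, ∀ m ∈ E₁.msg n,
    1 - ν n ≤ prob (do
      let k ← f.keyGen n
      let c ← E₁.enc n k.pk₁ m
      let c' ← f.apply n k.bk c
      E₂.dec n k.sk₂ c') (f.ι n m)

/-- Security of a bridge: IND-CPA security of `E₁` when, besides `pk₁`, also `pk₂` and the bridge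
key are public. -/
def Secure (f : PreBridge E₁ E₂) : Prop :=
  E₁.SecureGiven fun n => do
    let k ← f.keyGen n
    pure (k.pk₁, node k.pk₁ (node k.pk₂ k.bk))

/-- The composition `g ∘ f`. The keys of `E₂` that `f` generates are used by `g`, and the bridge
key is `(bk_f, pk₂, bk_g)`. -/
def comp (g : PreBridge E₂ E₃) (f : PreBridge E₁ E₂) : PreBridge E₁ E₃ where
  ι n m := g.ι n (f.ι n m)
  skStage n sk₁ := do
    let s ← f.skStage n sk₁
    let t ← g.skStage n s.fst
    pure (node t.fst (node s t.snd))
  bkStage n sk₁ pk₁ sk₃ pk₃ st := do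
    let pk₂ ← E₂.pkGen n st.fst.fst
    let bkf ← f.bkStage n sk₁ pk₁ st.fst.fst pk₂ st.fst.snd
    let bkg ← g.bkStage n st.fst.fst pk₂ sk₃ pk₃ st.snd
    pure (node bkf (node pk₂ bkg))
  apply n bk c := do
    let c₂ ← f.apply n bk.fst c
    g.apply n bk.snd.snd c₂

/-- Independent samples may be drawn in any order. -/
theorem bind_swap {α β γ δ ε : Type} (A : PMF α) (B : α → PMF β) (T : PMF γ)
    (P : γ → PMF δ) (K : α → β → γ → δ → PMF ε) :
    (T.bind fun t => (P t).bind fun p => A.bind fun a => (B a).bind fun b => K a b t p) =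
      A.bind fun a => (B a).bind fun b => T.bind fun t => (P t).bind fun p => K a b t p := by
  have h := PMF.bind_comm (T.bind fun t => (P t).bind fun p => PMF.pure (t, p))
    (A.bind fun a => (B a).bind fun b => PMF.pure (a, b)) fun x y => K y.1 y.2 x.1 x.2
  simpa only [PMF.bind_bind, PMF.pure_bind] using h

/-- The key generation of `g ∘ f` runs the key generation of `f` and then the second and the third
stage of the key generation of `g`. -/
theorem keyGen_comp (g : PreBridge E₂ E₃) (f : PreBridge E₁ E₂) (n : ℕ) :
    (g.comp f).keyGen n = (do
      let k ← f.keyGen n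
      let t ← g.skStage n k.sk₂
      let pk₃ ← E₃.pkGen n t.fst
      let bkg ← g.bkStage n k.sk₂ k.pk₂ t.fst pk₃ t.snd
      pure ⟨k.sk₁, k.pk₁, t.fst, pk₃, node k.bk (node k.pk₂ bkg)⟩) := by
  have hb : ∀ {α β : Type} (p : PMF α) (h : α → PMF β), (p >>= h) = p.bind h := fun _ _ => rfl
  have hp : ∀ {α : Type} (a : α), (pure a : PMF α) = PMF.pure a := fun _ => rfl
  have h1 : ∀ a b, (node a b).fst = a := fun _ _ => rfl
  have h2 : ∀ a b, (node a b).snd = b := fun _ _ => rfl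
  simp only [keyGen, hb, hp, comp, PMF.bind_bind, PMF.pure_bind, h1, h2]
  congr 1; funext sk₁
  congr 1; funext pk₁
  congr 1; funext s
  exact bind_swap _ _ _ _ _

end PreBridge

/-! ### Gentry-type bridges -/

/-- What is needed to evaluate `ι ∘ Dec` of `E` homomorphically in `H`: representations of the
secret keys and of the ciphertexts of `E` as bit strings, plaintexts `0` and `1` of `H`, and boolean
circuits over the plaintext space of `H` that compute `ι ∘ Dec`. -/
structure DecCircuit (E : PKE) (H : HE) (ι : ℕ → Data → Data) where
  skLen : ℕ → ℕ
  ctLen : ℕ → ℕ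
  len_poly : ∃ p : Polynomial ℕ, ∀ n, skLen n + ctLen n ≤ p.eval n
  /-- bit representation of secret keys -/
  skRep : ℕ → Data → List Bool
  skRep_polyTime : IsPolyTime fun n x => ofBits (skRep n x)
  skRep_length : ∀ n, ∀ sk ∈ (E.skGen n).support, (skRep n sk).length = skLen n
  skRep_inj : ∀ n, Set.InjOn (skRep n) (E.skGen n).support
  /-- bit representation of ciphertexts -/
  ctRep : ℕ → Data → List Bool
  ctRep_polyTime : IsPolyTime fun n x => ofBits (ctRep n x)
  ctRep_length : ∀ n, ∀ c ∈ E.ct n, (ctRep n c).length = ctLen n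
  ctRep_inj : ∀ n, Set.InjOn (ctRep n) (E.ct n)
  /-- the plaintext of `H` that stands for a bit -/
  bit : ℕ → Bool → Data
  bit_polyTime : ∀ b, IsPolyTime fun n _ => bit n b
  bit_mem : ∀ n b, bit n b ∈ H.msg n
  circ : ℕ → Circuit
  circ_polyTime : IsPolyTime fun n _ => (circ n).encode
  circ_isMap : ∀ n, (circ n).IsMap (H.msg n) (skLen n + ctLen n)
  circ_apply : ∀ n, ∀ sk ∈ (E.skGen n).support, ∀ c ∈ E.ct n, ∃ m, E.dec n sk c = pure m ∧
    (circ n).apply ((skRep n sk).map (bit n) ++ (ctRep n c).map (bit n)) = ι n m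

/-- Gentry-type bridges: the keys of `H` are generated independently of those of `E`; the bridge key
is the public key of `H` (which includes the evaluation key) with encryptions under it of the bits
of the secret key of `E`; the bridge algorithm encrypts the bits of the ciphertext under the public
key of `H` and evaluates `ι ∘ Dec` homomorphically. -/
def IsGentryType {E : PKE} {H : HE} (g : PreBridge E H.toPKE) : Prop :=
  g.IsBridge ∧ ∃ D : DecCircuit E H g.ι, ∀ n, ∀ sk ∈ (E.skGen n).support,
    g.skStage n sk = (do let skH ← H.skGen n; pure (node skH nil)) ∧
    ∀ pk ∈ (E.pkGen n sk).support, ∀ skH ∈ (H.skGen n).support, ∀ pkH ∈ (H.pkGen n skH).support,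
      g.bkStage n sk pk skH pkH nil =
        (do let v ← H.encList n pkH ((D.skRep n sk).map (D.bit n)); pure (node pkH v)) ∧
      ∀ v ∈ (H.encList n pkH ((D.skRep n sk).map (D.bit n))).support, ∀ c ∈ E.ct n,
        g.apply n (node pkH v) c = (do
          let cs ← H.encList n pkH ((D.ctRep n c).map (D.bit n))
          H.eval n pkH (D.circ n).encode (v.append cs))

end Crypto

end

noncomputable section

namespace Crypto

open Data

/-! ### Distributions -/

/-! Correctness. The output of `f` need not look like a fresh encryption, so correctness of `g` as a
bridge does not apply to it. A Gentry-type `g`, however, encrypts the bits of the given ciphertext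
afresh and evaluates `ι ∘ Dec` on them and on the encrypted secret key. Since decryption in `E₂` is
deterministic and the circuit has polynomial size, correctness of `H` makes this step right for all
keys and all ciphertexts, with error `ν` (`homomorphic_dec_correct`). If `f` errs with probability
at most `μ`, the composite succeeds with probability at least `(1 - ν) * (1 - μ)` when `ν ≤ 1`,
hence at least `1 - μ - ν` in all cases (`comp_correct`).

Security. An adversary against the composite sees the public data of `f` together with `pkH` and
encryptions of the bits of `sk₂`. Replace `sk₂` inside these encryptions by an independently
generated secret key. The whole IND-CPA game for `E₁`, with the keys of `f` sampled along the way,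
is a polynomial time test of what is encrypted under `pkH`; by security of `H` the replacement
changes the success probability negligibly. After it, the additional data can be generated from
scratch, since the keys of `H` are independent of all others, so the adversary becomes one against
`f` (`simulator`), whose advantage is negligible (`comp_secure`).

Security of `H` concerns one challenge message, while the bridge key consists of polynomially many
encryptions. A hybrid argument bridges the gap (`PKE.Secure.distinguish_negligible`): the reduction
plants its challenge at a random position, and the differences between neighbouring hybrids
telescope. With fair coins and strict time bounds the position is drawn uniformly below a power of
two; positions beyond the end of the list contribute nothing.

The reductions must be programs of the given language, so closure of polynomial time under
composition, branching, bounded iteration and folds over lists is established on the way. -/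

theorem bind_eq {α β : Type} (p : PMF α) (h : α → PMF β) : (p >>= h) = p.bind h := rfl

theorem pure_eq {α : Type} (a : α) : (pure a : PMF α) = PMF.pure a := rfl

/-- The conditions on keys, ciphertexts and Gentry-type bridges hold only for values that can occur;
this permits rewriting with them under a `bind`. -/
theorem bind_congr_support {α β : Type} {p : PMF α} {F G : α → PMF β}
    (h : ∀ a ∈ p.support, F a = G a) : p.bind F = p.bind G := by
  ext b
  simp only [PMF.bind_apply]
  refine tsum_congr fun a => ?_
  by_cases ha : a ∈ p.support
  · rw [h a ha]
  · rw [(PMF.apply_eq_zero_iff p a).2 ha, zero_mul, zero_mul]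

/-- Apply a random map `k` times. -/
def iterate {α : Type} (F : α → PMF α) : ℕ → α → PMF α
  | 0, y => PMF.pure y
  | k + 1, y => (F y).bind (iterate F k)

/-- The recursion of `iterate` splits off the first step; size invariants need the last one. -/
theorem mem_support_iterate_succ {α : Type} {F : α → PMF α} {k : ℕ} {y z : α} :
    z ∈ (iterate F (k + 1) y).support ↔
      ∃ w ∈ (iterate F k y).support, z ∈ (F w).support := by
  induction k generalizing y with
  | zero => simp [iterate]
  | succ k ih =>
    rw [iterate, PMF.mem_support_bind_iff]
    simp only [ih]
    rw [iterate]
    simp only [PMF.mem_support_bind_iff]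
    tauto

theorem iterate_map {α β : Type} {F : α → PMF α} {G : β → PMF β} {e : α → β}
    (h : ∀ y, G (e y) = (F y).map e) (k : ℕ) (y : α) :
    iterate G k (e y) = (iterate F k y).map e := by
  induction k generalizing y with
  | zero => simp [iterate, PMF.pure_map]
  | succ k ih =>
    rw [iterate, iterate, h, PMF.bind_map, PMF.map_bind]
    congr 1
    funext z
    exact ih z

/-! ### Polynomials with natural coefficients -/

theorem eval_le_eval (p : Polynomial ℕ) {a b : ℕ} (h : a ≤ b) : p.eval a ≤ p.eval b := by
  induction p using Polynomial.induction_on' with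
  | add p q hp hq => simpa using Nat.add_le_add hp hq
  | monomial n c => simpa using Nat.mul_le_mul_left c (Nat.pow_le_pow_left h n)

/-! ### Running times -/

@[simp] theorem Data.size_unary (n : ℕ) : (unary n).size = n := by
  induction n with
  | zero => rfl
  | succ n ih => simp [unary, Data.size, ih]

@[simp] theorem Data.fst_node (a b : Data) : (node a b).fst = a := rfl

@[simp] theorem Data.snd_node (a b : Data) : (node a b).snd = b := rfl

theorem Data.size_fst_le (x : Data) : x.fst.size ≤ x.size := by
  cases x <;> simp [Data.fst, Data.size]; omega

theorem Data.size_snd_le (x : Data) : x.snd.size ≤ x.size := by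
  cases x <;> simp [Data.snd, Data.size]; omega

/-- The distribution of the result of a program. -/
def Prog.out (P : Prog) (x : Data) : PMF Data := (P.run x).map Prod.fst

/-- On the input `x`, the program always stops after at most `t` steps. -/
def Prog.TimeLE (P : Prog) (x : Data) (t : ℕ) : Prop := ∀ r ∈ (P.run x).support, r.2 ≤ t

namespace Prog

theorem mem_support_out {P : Prog} {x : Data} {r : Data × ℕ} (h : r ∈ (P.run x).support) :
    r.1 ∈ (P.out x).support := by
  rw [out, PMF.mem_support_map_iff]
  exact ⟨r, h, rfl⟩

theorem TimeLE.mono {P : Prog} {x : Data} {s t : ℕ} (h : P.TimeLE x s) (hst : s ≤ t) :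
    P.TimeLE x t := fun r hr => (h r hr).trans hst

theorem out_nil (x : Data) : Prog.nil.out x = PMF.pure Data.nil := by
  simp [out, run, pure_eq, PMF.pure_map]

theorem out_fst (x : Data) : Prog.fst.out x = PMF.pure x.fst := by
  simp [out, run, pure_eq, PMF.pure_map]

theorem out_snd (x : Data) : Prog.snd.out x = PMF.pure x.snd := by
  simp [out, run, pure_eq, PMF.pure_map]

theorem out_coin (x : Data) : Prog.coin.out x = (PMF.uniformOfFintype Bool).map ofBit := by
  simp only [out, run, bind_eq, pure_eq, PMF.map_bind, PMF.pure_map]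
  rfl

theorem out_pair (p q : Prog) (x : Data) : (Prog.pair p q).out x =
    (p.out x).bind fun a => (q.out x).bind fun b => PMF.pure (node a b) := by
  simp only [out, run, bind_eq, pure_eq, PMF.map_bind, PMF.pure_map, PMF.bind_map,
    Function.comp_def]

theorem map_fst_bind_pure {α β γ : Type} (p : PMF (α × β)) (f : α × β → γ) :
    (p.bind fun s => PMF.pure (s.1, f s)).map Prod.fst = p.map Prod.fst := by
  rw [PMF.map_bind]
  simp only [PMF.pure_map]
  rfl

theorem out_comp (p q : Prog) (x : Data) : (Prog.comp p q).out x = (q.out x).bind p.out := by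
  simp only [out, run, bind_eq, pure_eq, PMF.bind_map, Function.comp_def]
  rw [PMF.map_bind]
  congr 1
  funext r
  exact map_fst_bind_pure _ _

theorem out_cond (c p q : Prog) (x : Data) : (Prog.cond c p q).out x =
    (c.out x).bind fun r => if r.toBit then p.out x else q.out x := by
  simp only [out, run, bind_eq, pure_eq, PMF.map_bind, PMF.bind_map, Function.comp_def]
  congr 1
  funext r
  split <;> exact map_fst_bind_pure _ _

theorem map_fst_loop (p : Prog) (k : ℕ) (y : Data) :
    (loop p.run k y).map Prod.fst = iterate p.out k y := by
  induction k generalizing y with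
  | zero => simp [loop, iterate, pure_eq, PMF.pure_map]
  | succ k ih =>
    simp only [loop, iterate, bind_eq, pure_eq, PMF.map_bind, PMF.pure_map, out, PMF.bind_map,
      Function.comp_def]
    congr 1
    funext r
    exact ih r.1

theorem out_iter (p : Prog) (x : Data) :
    (Prog.iter p).out x = iterate p.out x.fst.size x.snd := by
  rw [← map_fst_loop]
  simp only [out, run, bind_eq, pure_eq, PMF.map_bind, PMF.pure_map]
  rfl

theorem timeLE_nil (x : Data) : Prog.nil.TimeLE x (1 + x.size) := by
  simp [TimeLE, run, pure_eq]

theorem timeLE_fst (x : Data) : Prog.fst.TimeLE x (1 + x.size) := by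
  simp [TimeLE, run, pure_eq]

theorem timeLE_snd (x : Data) : Prog.snd.TimeLE x (1 + x.size) := by
  simp [TimeLE, run, pure_eq]

theorem timeLE_coin (x : Data) : Prog.coin.TimeLE x (1 + x.size) := by
  intro r hr
  simp only [run, bind_eq, pure_eq, PMF.mem_support_bind_iff, PMF.support_pure,
    Set.mem_singleton_iff] at hr
  obtain ⟨b, -, rfl⟩ := hr
  exact le_rfl

theorem TimeLE.pair {p q : Prog} {x : Data} {s t : ℕ} (hp : p.TimeLE x s) (hq : q.TimeLE x t) :
    (Prog.pair p q).TimeLE x (1 + x.size + s + t) := by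
  intro r hr
  simp only [run, bind_eq, pure_eq, PMF.mem_support_bind_iff, PMF.support_pure,
    Set.mem_singleton_iff] at hr
  obtain ⟨a, ha, b, hb, rfl⟩ := hr
  have := hp a ha
  have := hq b hb
  dsimp only
  omega

theorem TimeLE.comp {p q : Prog} {x : Data} {s t : ℕ} (hq : q.TimeLE x s)
    (hp : ∀ y ∈ (q.out x).support, p.TimeLE y t) :
    (Prog.comp p q).TimeLE x (1 + x.size + s + t) := by
  intro r hr
  simp only [run, bind_eq, pure_eq, PMF.mem_support_bind_iff, PMF.support_pure,
    Set.mem_singleton_iff] at hr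
  obtain ⟨a, ha, b, hb, rfl⟩ := hr
  have := hq a ha
  have := hp _ (mem_support_out ha) b hb
  dsimp only
  omega

theorem TimeLE.cond {c p q : Prog} {x : Data} {s t u : ℕ} (hc : c.TimeLE x s)
    (hp : p.TimeLE x t) (hq : q.TimeLE x u) :
    (Prog.cond c p q).TimeLE x (1 + x.size + s + (t + u)) := by
  intro r hr
  simp only [run, bind_eq, pure_eq] at hr
  obtain ⟨a, ha, hr⟩ := (PMF.mem_support_bind_iff _ _ _).1 hr
  have h1 := hc a ha
  split at hr <;>
  · simp only [PMF.mem_support_bind_iff, PMF.support_pure, Set.mem_singleton_iff] at hr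
    obtain ⟨b, hb, rfl⟩ := hr
    first | have := hp b hb | have := hq b hb
    dsimp only
    omega

/-- The bound `t` is required only on states reachable in fewer than `k` steps. States may grow, so
no bound could hold for all of them. -/
theorem loop_time_le {p : Prog} {t k : ℕ} {y : Data}
    (h : ∀ j < k, ∀ z ∈ (iterate p.out j y).support, p.TimeLE z t) :
    ∀ r ∈ (loop p.run k y).support, r.2 ≤ k * t := by
  induction k generalizing y with
  | zero => simp [loop, pure_eq]
  | succ k ih =>
    intro r hr
    simp only [loop, bind_eq, pure_eq, PMF.mem_support_bind_iff, PMF.support_pure,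
      Set.mem_singleton_iff] at hr
    obtain ⟨a, ha, b, hb, rfl⟩ := hr
    have h1 := h 0 (Nat.succ_pos k) y (by simp [iterate]) a ha
    have h2 := ih (y := a.1) (fun j hj z hz => h (j + 1) (by omega) z (by
      rw [iterate, PMF.mem_support_bind_iff]
      exact ⟨_, mem_support_out ha, hz⟩)) b hb
    dsimp only
    rw [add_mul, one_mul]
    omega

theorem TimeLE.iter {p : Prog} {x : Data} {t : ℕ}
    (h : ∀ j < x.fst.size, ∀ z ∈ (iterate p.out j x.snd).support, p.TimeLE z t) :
    (Prog.iter p).TimeLE x (1 + x.size + x.fst.size * t) := by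
  intro r hr
  simp only [run, bind_eq, pure_eq, PMF.mem_support_bind_iff, PMF.support_pure,
    Set.mem_singleton_iff] at hr
  obtain ⟨a, ha, rfl⟩ := hr
  have := loop_time_le h a ha
  dsimp only
  omega

theorem loop_size_le {F : Data → PMF (Data × ℕ)}
    (hF : ∀ y, ∀ r ∈ (F y).support, r.1.size ≤ r.2) {k : ℕ} {y : Data} :
    ∀ r ∈ (loop F k y).support, r.1.size ≤ y.size + r.2 := by
  induction k generalizing y with
  | zero => simp [loop, pure_eq]
  | succ k ih =>
    intro r hr
    simp only [loop, bind_eq, pure_eq, PMF.mem_support_bind_iff, PMF.support_pure,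
      Set.mem_singleton_iff] at hr
    obtain ⟨a, ha, b, hb, rfl⟩ := hr
    have := hF y a ha
    have := ih b hb
    dsimp only
    omega

/-- A program cannot write more than its running time allows. -/
theorem size_le_time (P : Prog) (x : Data) : ∀ r ∈ (P.run x).support, r.1.size ≤ r.2 := by
  induction P generalizing x with
  | id => simp [run, pure_eq]
  | nil => simp [run, pure_eq, Data.size]
  | fst =>
    simp only [run, pure_eq, PMF.support_pure, Set.mem_singleton_iff, forall_eq]
    have := Data.size_fst_le x
    omega
  | snd =>
    simp only [run, pure_eq, PMF.support_pure, Set.mem_singleton_iff, forall_eq]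
    have := Data.size_snd_le x
    omega
  | coin =>
    intro r hr
    simp only [run, bind_eq, pure_eq, PMF.mem_support_bind_iff, PMF.support_pure,
      Set.mem_singleton_iff] at hr
    obtain ⟨b, -, rfl⟩ := hr
    cases b <;> simp [ofBit, Data.size]
  | pair p q hp hq =>
    intro r hr
    simp only [run, bind_eq, pure_eq, PMF.mem_support_bind_iff, PMF.support_pure,
      Set.mem_singleton_iff] at hr
    obtain ⟨a, ha, b, hb, rfl⟩ := hr
    have := hp x a ha
    have := hq x b hb
    simp only [Data.size]
    omega
  | comp p q hp hq =>
    intro r hr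
    simp only [run, bind_eq, pure_eq, PMF.mem_support_bind_iff, PMF.support_pure,
      Set.mem_singleton_iff] at hr
    obtain ⟨a, ha, b, hb, rfl⟩ := hr
    have := hp a.1 b hb
    dsimp only
    omega
  | cond c p q hc hp hq =>
    intro r hr
    simp only [run, bind_eq, pure_eq] at hr
    obtain ⟨a, ha, hr⟩ := (PMF.mem_support_bind_iff _ _ _).1 hr
    split at hr <;>
    · simp only [PMF.mem_support_bind_iff, PMF.support_pure, Set.mem_singleton_iff] at hr
      obtain ⟨b, hb, rfl⟩ := hr
      first | have := hp x b hb | have := hq x b hb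
      dsimp only
      omega
  | iter p hp =>
    intro r hr
    simp only [run, bind_eq, pure_eq, PMF.mem_support_bind_iff, PMF.support_pure,
      Set.mem_singleton_iff] at hr
    obtain ⟨a, ha, rfl⟩ := hr
    have := loop_size_le hp a ha
    have := Data.size_snd_le x
    dsimp only
    omega

theorem TimeLE.size_le {P : Prog} {x : Data} {t : ℕ} (h : P.TimeLE x t) :
    ∀ y ∈ (P.out x).support, y.size ≤ t := by
  intro y hy
  rw [out, PMF.mem_support_map_iff] at hy
  obtain ⟨r, hr, rfl⟩ := hy
  exact (size_le_time P x r hr).trans (h r hr)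

theorem computes_iff {P : Prog} {A : ℕ → Data → PMF Data} :
    P.Computes A ↔ (∀ n x, P.out (node (unary n) x) = A n x) ∧
      ∃ p : Polynomial ℕ, ∀ n x, P.TimeLE (node (unary n) x) (p.eval (n + x.size)) :=
  Iff.rfl

/-- `B` after `A`, as programs that are also given the security parameter. -/
theorem Computes.bind {P Q : Prog} {A B : ℕ → Data → PMF Data} (hP : P.Computes A)
    (hQ : Q.Computes B) :
    (Prog.comp Q (Prog.pair Prog.fst P)).Computes fun n x => (A n x).bind (B n) := by
  rw [computes_iff] at *
  obtain ⟨hPo, p, hp⟩ := hP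
  obtain ⟨hQo, q, hq⟩ := hQ
  have ho : ∀ n x, (Prog.pair Prog.fst P).out (node (unary n) x) =
      (A n x).map (node (unary n)) := by
    intro n x
    rw [out_pair, out_fst, PMF.pure_bind, hPo]
    rfl
  refine ⟨fun n x => ?_, 3 * Polynomial.X + 6 + p + q.comp (Polynomial.X + p), fun n x => ?_⟩
  · rw [out_comp, ho, PMF.bind_map]
    congr 1
    funext y
    exact hQo n y
  · refine (TimeLE.comp ((timeLE_fst _).pair (hp n x)) (t := q.eval (n + x.size +
      p.eval (n + x.size))) fun y hy => ?_).mono ?_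
    · rw [ho, PMF.mem_support_map_iff] at hy
      obtain ⟨z, hz, rfl⟩ := hy
      rw [← hPo] at hz
      have := (hp n x).size_le z hz
      exact (hq n z).mono (eval_le_eval q (by omega))
    · simp only [Data.size, size_unary, Polynomial.eval_add, Polynomial.eval_mul,
        Polynomial.eval_X, Polynomial.eval_comp, Polynomial.eval_ofNat]
      omega

end Prog

/-! ### Closure properties of probabilistic polynomial time algorithms -/

theorem IsPPT.bind {A B : ℕ → Data → PMF Data} (hA : IsPPT A) (hB : IsPPT B) :
    IsPPT fun n x => (A n x).bind (B n) := by
  obtain ⟨P, hP⟩ := hA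
  obtain ⟨Q, hQ⟩ := hB
  exact ⟨_, hP.bind hQ⟩

theorem IsPolyTime.comp {F G : ℕ → Data → Data} (hG : IsPolyTime G) (hF : IsPolyTime F) :
    IsPolyTime fun n x => G n (F n x) := by
  obtain ⟨P, hPd, hP⟩ := hF
  obtain ⟨Q, hQd, hQ⟩ := hG
  refine ⟨.comp Q (.pair .fst P), ⟨hQd, trivial, hPd⟩, ?_⟩
  have := hP.bind hQ
  simpa only [pure_eq, PMF.pure_bind] using this

/-- Functions that some polynomial time algorithm computes with certainty. -/
def IsPoly (F : ℕ → Data → Data) : Prop := IsPPT fun n x => PMF.pure (F n x)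

theorem IsPolyTime.isPoly {F : ℕ → Data → Data} (h : IsPolyTime F) : IsPoly F := by
  obtain ⟨P, -, hP⟩ := h
  exact ⟨P, hP⟩

theorem IsPPT.size_le {A : ℕ → Data → PMF Data} (hA : IsPPT A) :
    ∃ p : Polynomial ℕ, ∀ n x, ∀ y ∈ (A n x).support, y.size ≤ p.eval (n + x.size) := by
  obtain ⟨P, hP⟩ := hA
  obtain ⟨ho, p, hp⟩ := Prog.computes_iff.1 hP
  refine ⟨p, fun n x y hy => ?_⟩
  rw [← ho] at hy
  exact (hp n x).size_le y hy

theorem IsPPT.subst {A : ℕ → Data → PMF Data} (hA : IsPPT A) {F : ℕ → Data → Data}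
    (hF : IsPoly F) : IsPPT fun n x => A n (F n x) := by
  simpa only [PMF.pure_bind] using IsPPT.bind hF hA

theorem IsPoly.subst {G F : ℕ → Data → Data} (hG : IsPoly G) (hF : IsPoly F) :
    IsPoly fun n x => G n (F n x) :=
  IsPPT.subst hG hF

theorem IsPPT.pair {A B : ℕ → Data → PMF Data} (hA : IsPPT A) (hB : IsPPT B) :
    IsPPT fun n x => (A n x).bind fun a => (B n x).bind fun b => PMF.pure (node a b) := by
  obtain ⟨P, hP⟩ := hA
  obtain ⟨Q, hQ⟩ := hB
  obtain ⟨hPo, p, hp⟩ := Prog.computes_iff.1 hP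
  obtain ⟨hQo, q, hq⟩ := Prog.computes_iff.1 hQ
  refine ⟨.pair P Q, Prog.computes_iff.2 ⟨fun n x => ?_, Polynomial.X + 2 + p + q, fun n x => ?_⟩⟩
  · rw [Prog.out_pair, hPo, hQo]
  · refine ((hp n x).pair (hq n x)).mono ?_
    simp only [Data.size, size_unary, Polynomial.eval_add, Polynomial.eval_X,
      Polynomial.eval_ofNat]
    omega

theorem IsPPT.cond {C A B : ℕ → Data → PMF Data} (hC : IsPPT C) (hA : IsPPT A) (hB : IsPPT B) :
    IsPPT fun n x => (C n x).bind fun r => if r.toBit then A n x else B n x := by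
  obtain ⟨R, hR⟩ := hC
  obtain ⟨P, hP⟩ := hA
  obtain ⟨Q, hQ⟩ := hB
  obtain ⟨hRo, r, hr⟩ := Prog.computes_iff.1 hR
  obtain ⟨hPo, p, hp⟩ := Prog.computes_iff.1 hP
  obtain ⟨hQo, q, hq⟩ := Prog.computes_iff.1 hQ
  refine ⟨.cond R P Q, Prog.computes_iff.2 ⟨fun n x => ?_, Polynomial.X + 2 + r + (p + q),
    fun n x => ?_⟩⟩
  · rw [Prog.out_cond, hPo, hQo, hRo]
  · refine ((hr n x).cond (hp n x) (hq n x)).mono ?_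
    simp only [Data.size, size_unary, Polynomial.eval_add, Polynomial.eval_X,
      Polynomial.eval_ofNat]
    omega

theorem IsPoly.id : IsPoly fun _ x => x :=
  ⟨.snd, Prog.computes_iff.2 ⟨fun _ _ => Prog.out_snd _, Polynomial.X + 2, fun n x =>
    (Prog.timeLE_snd _).mono (by simp [Data.size]; omega)⟩⟩

theorem IsPoly.nil : IsPoly fun _ _ => Data.nil :=
  ⟨.nil, Prog.computes_iff.2 ⟨fun _ _ => Prog.out_nil _, Polynomial.X + 2, fun n x =>
    (Prog.timeLE_nil _).mono (by simp [Data.size]; omega)⟩⟩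

theorem IsPPT.coin : IsPPT fun _ _ => (PMF.uniformOfFintype Bool).map ofBit :=
  ⟨.coin, Prog.computes_iff.2 ⟨fun _ _ => Prog.out_coin _, Polynomial.X + 2, fun n x =>
    (Prog.timeLE_coin _).mono (by simp [Data.size]; omega)⟩⟩

/-- Algorithms receive `1ⁿ` along with their argument; `Q` discards it before the bare instruction
`P` runs. -/
theorem isPoly_of_out {P Q : Prog} {F : Data → Data} (hP : ∀ x, P.out x = PMF.pure (F x))
    (hPt : ∀ x, P.TimeLE x (1 + x.size)) (hQ : Q.Computes fun _ x => PMF.pure x) :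
    IsPoly fun _ x => F x := by
  obtain ⟨hQo, q, hq⟩ := Prog.computes_iff.1 hQ
  refine ⟨.comp P Q, Prog.computes_iff.2 ⟨fun n x => ?_, 2 * Polynomial.X + 3 + q, fun n x => ?_⟩⟩
  · rw [Prog.out_comp, hQo, PMF.pure_bind, hP]
  · refine (Prog.TimeLE.comp (hq n x) (t := 1 + x.size) fun y hy => ?_).mono ?_
    · rw [hQo, PMF.support_pure, Set.mem_singleton_iff] at hy
      exact hy ▸ hPt y
    · simp only [Data.size, size_unary, Polynomial.eval_add, Polynomial.eval_X,
        Polynomial.eval_ofNat, Polynomial.eval_mul]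
      omega

theorem IsPoly.fst {F : ℕ → Data → Data} (hF : IsPoly F) : IsPoly fun n x => (F n x).fst := by
  obtain ⟨Q, hQ⟩ := IsPoly.id
  exact (isPoly_of_out Prog.out_fst Prog.timeLE_fst hQ).subst hF

theorem IsPoly.snd {F : ℕ → Data → Data} (hF : IsPoly F) : IsPoly fun n x => (F n x).snd := by
  obtain ⟨Q, hQ⟩ := IsPoly.id
  exact (isPoly_of_out Prog.out_snd Prog.timeLE_snd hQ).subst hF

theorem IsPoly.node {F G : ℕ → Data → Data} (hF : IsPoly F) (hG : IsPoly G) :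
    IsPoly fun n x => node (F n x) (G n x) := by
  rw [IsPoly]
  simpa only [PMF.pure_bind] using IsPPT.pair hF hG

/-- Sequential composition in which the second algorithm also receives the input of the first. -/
theorem IsPPT.bind' {A : ℕ → Data → PMF Data} {B : ℕ → Data → Data → PMF Data} (hA : IsPPT A)
    (hB : IsPPT fun n z => B n z.fst z.snd) : IsPPT fun n x => (A n x).bind (B n x) := by
  have h := (IsPPT.pair IsPoly.id hA).bind hB
  simp only [PMF.pure_bind, PMF.bind_bind] at h
  exact h

theorem IsPPT.ite {F : ℕ → Data → Data} {A B : ℕ → Data → PMF Data} (hF : IsPoly F)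
    (hA : IsPPT A) (hB : IsPPT B) :
    IsPPT fun n x => if (F n x).toBit then A n x else B n x := by
  simpa only [PMF.pure_bind] using IsPPT.cond hF hA hB

theorem IsPoly.ite {F G K : ℕ → Data → Data} (hF : IsPoly F) (hG : IsPoly G) (hK : IsPoly K) :
    IsPoly fun n x => if (F n x).toBit then G n x else K n x := by
  have h := IsPPT.ite hF hG hK
  have e : (fun n x => PMF.pure (if (F n x).toBit then G n x else K n x)) =
      fun n x => if (F n x).toBit then PMF.pure (G n x) else PMF.pure (K n x) := by
    funext n x
    split <;> rfl
  rwa [IsPoly, e]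

/-- Bounded iteration: if the states remain of polynomial size, then iteration takes polynomial
time. -/
theorem IsPPT.iterate {F : ℕ → Data → PMF Data} (hF : IsPPT F) (q : Polynomial ℕ)
    (hq : ∀ n k y, ∀ z ∈ (Crypto.iterate (F n) k y).support, z.size ≤ q.eval (n + k + y.size)) :
    IsPPT fun n (x : Data) => Crypto.iterate (F n) x.fst.size x.snd := by
  obtain ⟨P, hP⟩ := hF
  obtain ⟨hPo, p, hp⟩ := Prog.computes_iff.1 hP
  -- `iter` feeds each result back as the next input, so the state has to carry `1ⁿ`. `S` performs
  -- one step on such states, and `R` below brings the counter to the front, where `iter` expects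
  -- it.
  set S : Prog := .pair .fst P with hS
  have hSo : ∀ n y, S.out (Data.node (unary n) y) = (F n y).map (Data.node (unary n)) := by
    intro n y
    rw [hS, Prog.out_pair, Prog.out_fst, PMF.pure_bind, hPo]
    rfl
  set R : Prog := .pair (.comp .fst .snd) (.pair .fst (.comp .snd .snd)) with hR
  have hRo : ∀ n (x : Data), R.out (Data.node (unary n) x) =
      PMF.pure (Data.node x.fst (Data.node (unary n) x.snd)) := by
    intro n x
    simp only [hR, Prog.out_pair, Prog.out_comp, Prog.out_fst, Prog.out_snd, PMF.pure_bind]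
    rfl
  have hRt : ∀ n (x : Data), R.TimeLE (Data.node (unary n) x) (12 * (n + x.size + 2)) := by
    intro n x
    refine (((Prog.timeLE_snd _).comp (t := 1 + x.size) fun y hy => ?_).pair
      ((Prog.timeLE_fst _).pair ((Prog.timeLE_snd _).comp (t := 1 + x.size)
        fun y hy => ?_))).mono ?_
    · rw [Prog.out_snd, PMF.support_pure, Set.mem_singleton_iff] at hy
      exact hy ▸ Prog.timeLE_fst _
    · rw [Prog.out_snd, PMF.support_pure, Set.mem_singleton_iff] at hy
      exact hy ▸ Prog.timeLE_snd _
    · simp only [Data.size, size_unary]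
      omega
  have hIo : ∀ n (x : Data), (Prog.iter S).out (Data.node x.fst (Data.node (unary n) x.snd)) =
      (Crypto.iterate (F n) x.fst.size x.snd).map (Data.node (unary n)) := by
    intro n x
    rw [Prog.out_iter]
    exact iterate_map (hSo n) _ _
  let X : Polynomial ℕ := Polynomial.X
  -- `Z` bounds the size of every state that is reached, `T` the time of a single step.
  let Z : Polynomial ℕ := q.comp (2 * X)
  let T : Polynomial ℕ := 2 * X + 2 * Z + 4 + p.comp (X + Z)
  have hIt : ∀ n (x : Data), (Prog.iter S).TimeLE (Data.node x.fst (Data.node (unary n) x.snd))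
      (3 + 3 * (n + x.size) + (n + x.size) * T.eval (n + x.size)) := by
    intro n x
    have h1 := Data.size_fst_le x
    have h2 := Data.size_snd_le x
    have h3 : x.fst.size + x.snd.size ≤ x.size := by
      cases x <;> simp [Data.fst, Data.snd, Data.size]
    refine (Prog.TimeLE.iter (t := T.eval (n + x.size)) fun j hj z hz => ?_).mono ?_
    · have hz' := hz
      simp only [Data.snd_node] at hz'
      rw [iterate_map (hSo n), PMF.mem_support_map_iff] at hz'
      obtain ⟨w, hw, rfl⟩ := hz'
      have hw' := hq n j _ w hw
      simp only [Data.fst_node] at hj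
      have hw2 : w.size ≤ Z.eval (n + x.size) := by
        refine hw'.trans ?_
        simp only [Z, X, Polynomial.eval_comp, Polynomial.eval_mul, Polynomial.eval_X,
          Polynomial.eval_ofNat]
        exact eval_le_eval q (by omega)
      refine ((Prog.timeLE_fst _).pair (hp n w)).mono ?_
      have h4 := eval_le_eval p (show n + w.size ≤ n + x.size + Z.eval (n + x.size) by omega)
      simp only [T, X, Data.size, size_unary, Polynomial.eval_comp, Polynomial.eval_mul,
        Polynomial.eval_X, Polynomial.eval_ofNat, Polynomial.eval_add]
      omega
    · simp only [Data.size, size_unary, Data.fst_node]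
      have := Nat.mul_le_mul_right (T.eval (n + x.size)) (show x.fst.size ≤ n + x.size by omega)
      omega
  refine ⟨.comp .snd (.comp (.iter S) R), Prog.computes_iff.2 ⟨fun n (x : Data) => ?_,
    12 * (X + 2) + 2 * (X + 2) + (3 + 3 * X + X * T) + (X + Z + 2), fun n (x : Data) => ?_⟩⟩
  · rw [Prog.out_comp, Prog.out_comp, hRo, PMF.pure_bind, hIo, PMF.bind_map]
    simp only [Function.comp_def, Prog.out_snd, Data.snd_node]
    exact PMF.bind_pure _
  · refine (((hRt n x).comp (t := 3 + 3 * (n + x.size) + (n + x.size) * T.eval (n + x.size))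
      fun y hy => ?_).comp (t := 2 + (n + x.size) + Z.eval (n + x.size)) fun y hy => ?_).mono ?_
    · rw [hRo, PMF.support_pure, Set.mem_singleton_iff] at hy
      exact hy ▸ hIt n x
    · rw [Prog.out_comp, hRo, PMF.pure_bind, hIo, PMF.mem_support_map_iff] at hy
      obtain ⟨w, hw, rfl⟩ := hy
      have hw' := hq _ _ _ w hw
      have h3 : x.fst.size + x.snd.size ≤ x.size := by
        cases x <;> simp [Data.fst, Data.snd, Data.size]
      have hw2 : w.size ≤ Z.eval (n + x.size) := by
        refine hw'.trans ?_
        simp only [Z, X, Polynomial.eval_comp, Polynomial.eval_mul, Polynomial.eval_X,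
          Polynomial.eval_ofNat]
        exact eval_le_eval q (by omega)
      refine (Prog.timeLE_snd _).mono ?_
      simp only [Data.size, size_unary]
      omega
    · simp only [X, Data.size, size_unary, Polynomial.eval_mul,
        Polynomial.eval_X, Polynomial.eval_ofNat, Polynomial.eval_add]
      omega

/-! ### Lists as data -/

@[simp] theorem Data.toList_ofList (l : List Data) : (ofList l).toList = l := by
  induction l with
  | nil => rfl
  | cons a l ih => simp [ofList, Data.toList, ih]

@[simp] theorem Data.ofList_toList (d : Data) : ofList d.toList = d := by
  induction d with
  | nil => rfl
  | node a l _ ih => simp [ofList, Data.toList, ih]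

@[simp] theorem Data.toBit_ofBit (b : Bool) : (ofBit b).toBit = b := by
  cases b <;> rfl

@[simp] theorem Data.toBits_ofBits (l : List Bool) : (ofBits l).toBits = l := by
  simp [toBits, ofBits, Function.comp_def]

theorem Data.length_toList_le (d : Data) : d.toList.length ≤ d.size := by
  induction d with
  | nil => simp [Data.toList]
  | node a l _ ih => simp only [Data.toList, List.length_cons, Data.size]; omega

theorem Data.size_ofList (l : List Data) : (ofList l).size = (l.map fun a => a.size + 1).sum := by
  induction l with
  | nil => rfl
  | cons a l ih => simp only [ofList, Data.size, ih, List.map_cons, List.sum_cons]; omega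

theorem Data.append_eq (x y : Data) : x.append y = ofList (x.toList ++ y.toList) := by
  induction x with
  | nil => simp [Data.append, Data.toList]
  | node a l _ ih => simp [Data.append, Data.toList, ofList, ih]

theorem Data.append_nil (x : Data) : x.append Data.nil = x := by
  simp [Data.append_eq, Data.toList]

theorem Data.unary_eq (n : ℕ) : unary n = ofList (List.replicate n Data.nil) := by
  induction n with
  | zero => rfl
  | succ n ih => simp [unary, List.replicate_succ, ofList, ih]

theorem Data.snd_iterate_ofList (k : ℕ) (l : List Data) :
    Data.snd^[k] (ofList l) = ofList (l.drop k) := by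
  induction k generalizing l with
  | zero => rfl
  | succ k ih =>
    rw [Function.iterate_succ_apply]
    cases l with
    | nil => exact (ih []).trans (by simp)
    | cons a l => exact ih l

theorem Data.toBit_ofList (l : List Data) : (ofList l).toBit = !l.isEmpty := by
  cases l <;> rfl

/-! ### Folding over a list -/

/-- Fold a random operation over a list. -/
def foldData (G : Data → Data → PMF Data) : List Data → Data → PMF Data
  | [], acc => PMF.pure acc
  | a :: l, acc => (G a acc).bind (foldData G l)

theorem foldData_append (G : Data → Data → PMF Data) (l₁ l₂ : List Data) (acc : Data) :
    foldData G (l₁ ++ l₂) acc = (foldData G l₁ acc).bind (foldData G l₂) := by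
  induction l₁ generalizing acc with
  | nil => simp [foldData]
  | cons a l ih =>
    simp only [List.cons_append, foldData, PMF.bind_bind]
    congr 1
    funext z
    exact ih z

/-- One step of a fold, on the state `(ctx, list, accumulator)`. -/
def foldStep (G : Data → Data → Data → PMF Data) (y : Data) : PMF Data :=
  if y.snd.fst.toBit then
    (G y.fst y.snd.fst.fst y.snd.snd).bind fun z => PMF.pure (node y.fst (node y.snd.fst.snd z))
  else PMF.pure y

/-- Steps after the end of the list are idle, so any `k` above its length will do. In particular the
list itself, whose size is at least its length, can serve as the counter. -/
theorem iterate_foldStep (G : Data → Data → Data → PMF Data) (c : Data) (l : List Data) (k : ℕ)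
    (hk : l.length ≤ k) (acc : Data) :
    iterate (foldStep G) k (node c (node (ofList l) acc)) =
      (foldData (G c) l acc).map fun z => node c (node Data.nil z) := by
  induction k generalizing l acc with
  | zero =>
    obtain rfl : l = [] := List.length_eq_zero_iff.1 (by omega)
    simp [iterate, foldData, PMF.pure_map, ofList]
  | succ k ih =>
    cases l with
    | nil =>
      have := ih [] (Nat.zero_le _) acc
      simp only [ofList, foldData] at this
      simp [iterate, foldStep, foldData, ofList, toBit, this]
    | cons a l =>
      simp only [List.length_cons] at hk
      simp only [iterate, foldStep, foldData, ofList, fst_node, snd_node, toBit, if_true,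
        PMF.bind_bind, PMF.pure_bind, PMF.map_bind]
      congr 1
      funext z
      exact ih l (by omega) z

/-- Context and remaining list together never grow. Hence the allowance for each step is controlled
by the initial state, and the increments add up instead of compounding. -/
theorem size_foldStep {G : Data → Data → Data → PMF Data} {q : Polynomial ℕ} {n : ℕ}
    (hq : ∀ c a acc, ∀ z ∈ (G c a acc).support, z.size ≤ acc.size + q.eval (n + c.size + a.size))
    (y : Data) : ∀ z ∈ (foldStep G y).support,
      z.fst.size + z.snd.fst.size ≤ y.fst.size + y.snd.fst.size ∧
      z.size ≤ y.size + q.eval (n + (y.fst.size + y.snd.fst.size)) := by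
  intro z hz
  rw [foldStep] at hz
  split at hz
  · rename_i hb
    rcases y with _ | ⟨c, _ | ⟨_ | ⟨a, l⟩, acc⟩⟩
    · simp [Data.snd, Data.fst, toBit] at hb
    · simp [Data.snd, Data.fst, toBit] at hb
    · simp [Data.snd, Data.fst, toBit] at hb
    simp only [fst_node, snd_node, PMF.mem_support_bind_iff, PMF.support_pure,
      Set.mem_singleton_iff] at hz ⊢
    obtain ⟨w, hw, rfl⟩ := hz
    have h1 := hq c a acc w hw
    have h2 := eval_le_eval q (show n + c.size + a.size ≤ n + (c.size + (node a l).size) by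
      simp only [Data.size]; omega)
    simp only [fst_node, snd_node, Data.size] at h2 ⊢
    omega
  · rw [PMF.support_pure, Set.mem_singleton_iff] at hz
    subst hz
    exact ⟨le_rfl, Nat.le_add_right _ _⟩

theorem size_iterate_foldStep {G : Data → Data → Data → PMF Data} {q : Polynomial ℕ} {n : ℕ}
    (hq : ∀ c a acc, ∀ z ∈ (G c a acc).support, z.size ≤ acc.size + q.eval (n + c.size + a.size))
    (k : ℕ) (y : Data) : ∀ z ∈ (iterate (foldStep G) k y).support,
      z.fst.size + z.snd.fst.size ≤ y.fst.size + y.snd.fst.size ∧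
      z.size ≤ y.size + k * q.eval (n + (y.fst.size + y.snd.fst.size)) := by
  induction k with
  | zero => simp [iterate]
  | succ k ih =>
    intro z hz
    obtain ⟨w, hw, hz⟩ := mem_support_iterate_succ.1 hz
    obtain ⟨h1, h2⟩ := ih w hw
    obtain ⟨h3, h4⟩ := size_foldStep hq w z hz
    have h5 := eval_le_eval q (show n + (w.fst.size + w.snd.fst.size) ≤
      n + (y.fst.size + y.snd.fst.size) by omega)
    refine ⟨h3.trans h1, ?_⟩
    rw [add_mul, one_mul]
    omega

/-- Folds with an accumulator that grows slowly take polynomial time. -/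
theorem IsPPT.foldData {G : ℕ → Data → Data → Data → PMF Data}
    (hG : IsPPT fun n x => G n x.fst x.snd.fst x.snd.snd) (q : Polynomial ℕ)
    (hq : ∀ n c a acc, ∀ z ∈ (G n c a acc).support,
      z.size ≤ acc.size + q.eval (n + c.size + a.size)) :
    IsPPT fun n x => Crypto.foldData (G n x.fst) x.snd.fst.toList x.snd.snd := by
  have hF : IsPPT fun n y => foldStep (G n) y := by
    refine IsPPT.ite IsPoly.id.snd.fst (IsPPT.bind' (hG.subst
      (F := fun _ y => Data.node y.fst (Data.node y.snd.fst.fst y.snd.snd))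
      (IsPoly.id.fst.node (IsPoly.id.snd.fst.fst.node IsPoly.id.snd.snd))) ?_) IsPoly.id
    exact IsPoly.id.fst.fst.node (IsPoly.id.fst.snd.fst.snd.node IsPoly.id.snd)
  have hI := IsPPT.iterate hF (Polynomial.X + Polynomial.X * q) fun n k y z hz => by
    refine (size_iterate_foldStep (hq n) k y z hz).2.trans ?_
    have h1 := Data.size_snd_le y
    have h3 : y.fst.size + y.snd.fst.size ≤ y.size := by
      rcases y with _ | ⟨c, d⟩
      · simp [Data.fst, Data.snd, Data.size]
      · have := Data.size_fst_le d
        simp only [Data.size, fst_node, snd_node]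
        omega
    have h4 := eval_le_eval q (show n + (y.fst.size + y.snd.fst.size) ≤ n + k + y.size by omega)
    have h5 := Nat.mul_le_mul (show k ≤ n + k + y.size by omega) h4
    simp only [Polynomial.eval_add, Polynomial.eval_mul, Polynomial.eval_X]
    omega
  have hI' := IsPPT.bind (hI.subst (F := fun _ x => Data.node x.snd.fst
    (Data.node x.fst (Data.node x.snd.fst x.snd.snd)))
    (IsPoly.id.snd.fst.node (IsPoly.id.fst.node (IsPoly.id.snd.fst.node IsPoly.id.snd.snd))))
    IsPoly.id.snd.snd
  have e : (fun n (x : Data) => Crypto.foldData (G n x.fst) x.snd.fst.toList x.snd.snd) =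
      fun n x => (Crypto.iterate (foldStep (G n)) x.snd.fst.size
        (Data.node x.fst (Data.node x.snd.fst x.snd.snd))).bind fun z => PMF.pure z.snd.snd := by
    funext n x
    have := iterate_foldStep (G n) x.fst x.snd.fst.toList x.snd.fst.size
      (Data.length_toList_le _) x.snd.snd
    rw [Data.ofList_toList] at this
    rw [this, PMF.bind_map]
    exact (PMF.bind_pure _).symm
  rw [e]
  exact hI'

/-- Iteration of a function that increases the size by a constant at most. -/
theorem IsPoly.iterate {F : Data → Data} (hF : IsPoly fun _ => F) (b : ℕ)
    (hb : ∀ y, (F y).size ≤ y.size + b) : IsPoly fun _ x => F^[x.fst.size] x.snd := by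
  have e : ∀ k y, Crypto.iterate (fun y => PMF.pure (F y)) k y = PMF.pure (F^[k] y) := by
    intro k
    induction k with
    | zero => intro y; rfl
    | succ k ih => intro y; simp [Crypto.iterate, ih]
  have hs : ∀ k y, (F^[k] y).size ≤ y.size + k * b := by
    intro k y
    induction k with
    | zero => simp
    | succ k ih =>
      rw [Function.iterate_succ_apply', add_mul, one_mul]
      have := hb (F^[k] y)
      omega
  have h := IsPPT.iterate hF (Polynomial.X * (Polynomial.C b + 1)) fun n k y z hz => by
    rw [e, PMF.support_pure, Set.mem_singleton_iff] at hz
    subst hz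
    refine (hs k y).trans ?_
    simp only [Polynomial.eval_mul, Polynomial.eval_add, Polynomial.eval_X, Polynomial.eval_C,
      Polynomial.eval_one]
    nlinarith [Nat.zero_le (n * b), Nat.zero_le (y.size * b)]
  simp only [e] at h
  exact h

/-- The reversal of the list `x`, followed by the list `y`. -/
def revAppend (x y : Data) : Data := ofList (x.toList.reverse ++ y.toList)

theorem size_revAppend (x y : Data) : (revAppend x y).size = x.size + y.size := by
  obtain ⟨l, rfl⟩ : ∃ l, x = ofList l := ⟨_, (Data.ofList_toList x).symm⟩
  obtain ⟨m, rfl⟩ : ∃ m, y = ofList m := ⟨_, (Data.ofList_toList y).symm⟩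
  simp [revAppend, Data.size_ofList]

/-- Unary numbers are lists of `nil`, which reversal does not change; so `revAppend` doubles as
addition. -/
theorem revAppend_unary (a b : ℕ) : revAppend (unary a) (unary b) = unary (a + b) := by
  rw [revAppend, Data.unary_eq, Data.unary_eq, Data.unary_eq, Data.toList_ofList,
    Data.toList_ofList, List.reverse_replicate, List.replicate_append_replicate]

theorem isPoly_revAppend {F G : ℕ → Data → Data} (hF : IsPoly F) (hG : IsPoly G) :
    IsPoly fun n x => revAppend (F n x) (G n x) := by
  have h := IsPPT.foldData (G := fun _ _ a acc => PMF.pure (node a acc))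
    (IsPoly.id.snd.fst.node IsPoly.id.snd.snd) (Polynomial.X + 1) fun n c a acc z hz => by
      rw [PMF.support_pure, Set.mem_singleton_iff] at hz
      subst hz
      simp only [Data.size, Polynomial.eval_add, Polynomial.eval_X, Polynomial.eval_one]
      omega
  have e : ∀ l acc, foldData (fun a acc => PMF.pure (node a acc)) l acc =
      PMF.pure (ofList (l.reverse ++ acc.toList)) := by
    intro l
    induction l with
    | nil => intro acc; simp [foldData]
    | cons a l ih => intro acc; simp [foldData, ih, Data.toList]
  simp only [e] at h
  exact IsPoly.subst h (F := fun n x => node Data.nil (node (F n x) (G n x)))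
    (IsPoly.nil.node (hF.node hG))

/-! ### A random index -/

/-- One step of the sampling of a random index: as long as `u` is smaller than the length of the
list `c`, add `u` or `0` to `r`, each with probability one half, and double `u`. -/
def indexStep (c acc : Data) : PMF Data :=
  if (Data.snd^[acc.fst.size] c).toBit then
    ((PMF.uniformOfFintype Bool).map ofBit).bind fun b =>
      if b.toBit then
        PMF.pure (node (revAppend acc.fst acc.fst) (revAppend acc.fst acc.snd))
      else PMF.pure (node (revAppend acc.fst acc.fst) acc.snd)
  else PMF.pure acc

/-- A random index into the list `c`, uniform below a power of two. -/
def randomIndex (c : Data) : PMF Data :=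
  (foldData (fun _ => indexStep c) c.toList (node (unary 1) Data.nil)).bind fun z =>
    PMF.pure z.snd

theorem Data.size_lt_of_toBit_iterate {k : ℕ} {c : Data} (h : (Data.snd^[k] c).toBit = true) :
    k < c.size := by
  rw [← Data.ofList_toList c, Data.snd_iterate_ofList, Data.toBit_ofList] at h
  have h1 : k < c.toList.length := by
    by_contra hk
    rw [List.drop_eq_nil_of_le (by omega)] at h
    simp at h
  exact h1.trans_le (Data.length_toList_le c)

theorem isPPT_randomIndex : IsPPT fun _ x => randomIndex x := by
  have hd : IsPoly fun _ x => Data.snd^[x.snd.snd.fst.size] x.fst :=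
    (IsPoly.iterate IsPoly.id.snd 0 Data.size_snd_le).subst
      (F := fun _ x => node x.snd.snd.fst x.fst) (IsPoly.id.snd.snd.fst.node IsPoly.id.fst)
  have hu : IsPoly fun _ x => revAppend x.fst.snd.snd.fst x.fst.snd.snd.fst :=
    isPoly_revAppend IsPoly.id.fst.snd.snd.fst IsPoly.id.fst.snd.snd.fst
  have h := IsPPT.foldData (G := fun _ c _ acc => indexStep c acc) (q := 2 * Polynomial.X)
    (IsPPT.ite hd (IsPPT.bind' IsPPT.coin (IsPPT.ite IsPoly.id.snd
      (hu.node (isPoly_revAppend IsPoly.id.fst.snd.snd.fst IsPoly.id.fst.snd.snd.snd))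
      (hu.node IsPoly.id.fst.snd.snd.snd))) IsPoly.id.snd.snd) fun n c a acc z hz => by
    rw [indexStep] at hz
    simp only [Polynomial.eval_mul, Polynomial.eval_X, Polynomial.eval_ofNat]
    split at hz
    · rename_i hb
      -- A step that changes the state adds at most `2 * u` to its size, and it occurs only while `u
      -- < c.size`. This is the allowance `2 * X`.
      have h1 := Data.size_lt_of_toBit_iterate hb
      have h2 : acc.snd.size + acc.fst.size + 1 ≤ acc.size ∨ acc = Data.nil := by
        rcases acc with _ | ⟨u, r⟩
        · exact Or.inr rfl
        · left; simp only [fst_node, snd_node, Data.size]; omega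
      have h3 : z.size ≤ 3 * acc.fst.size + acc.snd.size + 1 := by
        obtain ⟨b, -, hz⟩ := (PMF.mem_support_bind_iff _ _ _).1 hz
        split at hz <;>
        · rw [PMF.support_pure, Set.mem_singleton_iff] at hz
          subst hz
          simp only [Data.size, size_revAppend]
          omega
      rcases h2 with h2 | rfl
      · omega
      · simp only [Data.fst, Data.snd, Data.size] at *
        omega
    · rw [PMF.support_pure, Set.mem_singleton_iff] at hz
      subst hz
      omega
  exact IsPPT.bind (h.subst (F := fun _ x => node x (node x (node (unary 1) Data.nil)))
    (IsPoly.id.node (IsPoly.id.node ((IsPoly.nil.node IsPoly.nil).node IsPoly.nil))))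
    IsPoly.id.snd

/-- How often `m` steps double `u` before it reaches `L`. -/
def doublings (L : ℕ) : ℕ → ℕ → ℕ
  | 0, _ => 0
  | m + 1, u => if u < L then doublings L m (2 * u) + 1 else doublings L m u

/-- Either all `m` steps double `u`, or `u` reaches `L` and stops. With `u = 1` and `m = L` the
minimum is `L`, because `L ≤ 2 ^ L`. -/
theorem le_doublings (L m u : ℕ) : min (u * 2 ^ m) L ≤ u * 2 ^ doublings L m u := by
  induction m generalizing u with
  | zero => simp [doublings]
  | succ m ih =>
    rw [doublings]
    split
    · have := ih (2 * u)
      rwa [pow_succ', pow_succ', ← mul_assoc, ← mul_assoc, mul_comm u 2]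
    · have : u * 1 ≤ u * 2 ^ doublings L m u := Nat.mul_le_mul_left u Nat.one_le_two_pow
      omega

/-- A doubling happens only below `L`, so it cannot lead beyond `2 * L`. -/
theorem doublings_le (L m u : ℕ) : u * 2 ^ doublings L m u ≤ max u (2 * L) := by
  induction m generalizing u with
  | zero => simp [doublings]
  | succ m ih =>
    rw [doublings]
    split
    · have := ih (2 * u)
      rw [pow_succ, show u * (2 ^ doublings L m (2 * u) * 2) =
        2 * u * 2 ^ doublings L m (2 * u) by ring]
      omega
    · exact ih u

theorem uniform_bind_apply {α : Type} (F : Bool → PMF α) (a : α) :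
    ((PMF.uniformOfFintype Bool).bind F) a * 2 = F true a + F false a := by
  rw [PMF.bind_apply, tsum_bool]
  simp only [PMF.uniformOfFintype_apply, Fintype.card_bool, Nat.cast_ofNat]
  rw [← mul_add, mul_comm, ← mul_assoc, ENNReal.mul_inv_cancel (by simp) (by simp), one_mul,
    add_comm]

theorem sum_range_two_mul {M : Type} [AddCommMonoid M] (f : ℕ → M) (k : ℕ) :
    ∑ i ∈ Finset.range (2 * k), f i = ∑ i ∈ Finset.range k, (f (2 * i + 1) + f (2 * i)) := by
  induction k with
  | zero => simp
  | succ k ih =>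
    rw [show 2 * (k + 1) = 2 * k + 1 + 1 by ring, Finset.sum_range_succ, Finset.sum_range_succ,
      Finset.sum_range_succ, ih, add_assoc, add_comm (f (2 * k))]

/-- Invariant of the sampling: from the state `(u, r)` the final index is `r + u * i`, with `i`
uniform below `2 ^ d` for the number `d` of doublings still to come. The next coin is the lowest
binary digit of `i`, so the sum splits by parity. Multiplying by `2 ^ d` avoids division in
`ENNReal`. -/
theorem foldData_indexStep_apply {α : Type} (c : Data) (l : List Data) (u r : ℕ)
    (F : Data → PMF α) (a : α) :
    ((foldData (fun _ => indexStep c) l (node (unary u) (unary r))).bind fun z => F z.snd) a *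
        2 ^ doublings c.toList.length l.length u =
      ∑ i ∈ Finset.range (2 ^ doublings c.toList.length l.length u), F (unary (r + u * i)) a := by
  induction l generalizing u r with
  | nil => simp [foldData, doublings]
  | cons x l ih =>
    have hb : (Data.snd^[u] c).toBit = decide (u < c.toList.length) := by
      conv_lhs => rw [← Data.ofList_toList c]
      rw [Data.snd_iterate_ofList, Data.toBit_ofList]
      by_cases h : u < c.toList.length
      · rw [decide_eq_true h]
        cases hd : c.toList.drop u with
        | nil => rw [List.drop_eq_nil_iff] at hd; omega
        | cons => rfl
      · rw [List.drop_eq_nil_of_le (by omega), decide_eq_false h]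
        rfl
    simp only [foldData, List.length_cons, doublings]
    by_cases h : u < c.toList.length
    · rw [if_pos h, pow_succ' (2 : ℕ), pow_succ' (2 : ENNReal), sum_range_two_mul]
      simp only [indexStep, fst_node, snd_node, Data.size_unary, hb, decide_eq_true h, if_true,
        revAppend_unary, PMF.bind_map, Function.comp_def, Data.toBit_ofBit, PMF.bind_bind]
      rw [show ∀ p q : ENNReal, p * (2 * q) = p * 2 * q by intro p q; ring, uniform_bind_apply,
        add_mul]
      simp only [if_true, Bool.false_eq_true, if_false, PMF.pure_bind]
      rw [← two_mul, ih, ih, ← Finset.sum_add_distrib]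
      refine Finset.sum_congr rfl fun i _ => ?_
      congr 3 <;> ring_nf
    · rw [if_neg h]
      simp only [indexStep, fst_node, Data.size_unary, hb, decide_eq_false h, Bool.false_eq_true,
        if_false, PMF.pure_bind]
      exact ih u r

/-- The number of values of `randomIndex` for lists of length `L`. -/
def indexRange (L : ℕ) : ℕ := 2 ^ doublings L L 1

theorem le_indexRange (L : ℕ) : L ≤ indexRange L := by
  have h := le_doublings L L 1
  have := (Nat.lt_two_pow_self (n := L)).le
  rw [one_mul, one_mul, min_eq_right this] at h
  exact h

theorem indexRange_le (L : ℕ) : indexRange L ≤ 2 * L + 1 := by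
  have h := doublings_le L L 1
  rw [one_mul] at h
  rw [indexRange]
  omega

theorem randomIndex_bind_apply {α : Type} (c : Data) (F : Data → PMF α) (a : α) :
    ((randomIndex c).bind F) a * indexRange c.toList.length =
      ∑ i ∈ Finset.range (indexRange c.toList.length), F (unary i) a := by
  have h := foldData_indexStep_apply c c.toList 1 0 F a
  simp only [zero_add, one_mul] at h
  simp only [randomIndex, PMF.bind_bind, PMF.pure_bind, indexRange, Nat.cast_pow, Nat.cast_ofNat]
  exact h

/-! ### Splitting a list -/

/-- Move the first element of the second list to the first list. -/
def moveFirst (y : Data) : Data := node (node y.snd.fst y.fst) y.snd.snd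

theorem snd_moveFirst_iterate (k : ℕ) (y : Data) :
    (moveFirst^[k] y).snd = Data.snd^[k] y.snd := by
  induction k generalizing y with
  | zero => rfl
  | succ k ih =>
    rw [Function.iterate_succ_apply, Function.iterate_succ_apply, ih]
    rfl

theorem moveFirst_iterate (k : ℕ) (f l : List Data) (hk : k ≤ l.length) :
    moveFirst^[k] (node (ofList f) (ofList l)) =
      node (ofList ((l.take k).reverse ++ f)) (ofList (l.drop k)) := by
  induction k generalizing f l with
  | zero => simp
  | succ k ih =>
    cases l with
    | nil => simp at hk
    | cons a l =>
      rw [Function.iterate_succ_apply]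
      have := ih (a :: f) l (by simpa using hk)
      rw [List.take_succ_cons, List.reverse_cons, List.append_assoc]
      exact this

theorem isPoly_moveFirst_iterate {F G : ℕ → Data → Data} (hF : IsPoly F) (hG : IsPoly G) :
    IsPoly fun n x => moveFirst^[(F n x).size] (G n x) := by
  have h : IsPoly fun _ => moveFirst :=
    (IsPoly.id.snd.fst.node IsPoly.id.fst).node IsPoly.id.snd.snd
  refine IsPoly.subst (h.iterate 2 fun y => ?_) (hF.node hG)
  rcases y with _ | ⟨a, _ | ⟨b, c⟩⟩ <;>
    simp only [moveFirst, Data.fst, Data.snd, Data.size] <;> omega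

/-! ### Probabilities -/

theorem prob_le_one {α : Type} (p : PMF α) (a : α) : prob p a ≤ 1 := by
  have := ENNReal.toReal_mono ENNReal.one_ne_top (p.coe_le_one a)
  simpa [prob] using this

theorem prob_nonneg {α : Type} (p : PMF α) (a : α) : 0 ≤ prob p a := ENNReal.toReal_nonneg

theorem prob_true_add_false (p : PMF Bool) : prob p true + prob p false = 1 := by
  have h := p.tsum_coe
  rw [tsum_bool] at h
  rw [prob, prob, ← ENNReal.toReal_add (p.apply_ne_top _) (p.apply_ne_top _), add_comm, h,
    ENNReal.toReal_one]

theorem prob_uniform_bind {α : Type} (F : Bool → PMF α) (a : α) :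
    prob ((PMF.uniformOfFintype Bool).bind F) a = (prob (F true) a + prob (F false) a) / 2 := by
  have h := congrArg ENNReal.toReal (uniform_bind_apply F a)
  rw [ENNReal.toReal_mul, ENNReal.toReal_add (PMF.apply_ne_top _ _) (PMF.apply_ne_top _ _)] at h
  simp only [prob]
  simp only [ENNReal.toReal_ofNat] at h
  linarith

theorem prob_bind_beq (p : PMF Bool) (b b' : Bool) :
    prob (p.bind fun d => PMF.pure (d == b)) b' = prob p (b' == b) := by
  simp only [prob]
  congr 1
  rw [PMF.bind_apply, tsum_bool]
  cases b <;> cases b' <;> simp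

/-- The advantage in guessing a bit is the advantage in distinguishing the two cases. -/
theorem prob_guess {α : Type} (p : PMF α) (T : α → Bool → PMF Bool) :
    prob (p.bind fun a => (PMF.uniformOfFintype Bool).bind fun b =>
        (T a b).bind fun d => PMF.pure (d == b)) true -
      prob (p.bind fun a => (PMF.uniformOfFintype Bool).bind fun b =>
        (T a b).bind fun d => PMF.pure (d == b)) false =
      prob (p.bind fun a => T a true) true - prob (p.bind fun a => T a false) true := by
  -- The coin is independent of `a` and may be tossed first; what remains is the average of the two
  -- fixed cases.
  rw [PMF.bind_comm]
  simp only [← PMF.bind_bind]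
  rw [prob_uniform_bind, prob_uniform_bind]
  simp only [prob_bind_beq]
  have h1 := prob_true_add_false (p.bind fun a => T a true)
  have h0 := prob_true_add_false (p.bind fun a => T a false)
  simp only [beq_self_eq_true, Bool.true_beq, Bool.false_beq, Bool.not_true]
  linarith

/-- Bound a mixture from below. -/
theorem mul_bind_apply_le {α β γ : Type} {p : PMF α} {F : α → PMF β} {G : α → PMF γ} {t : ENNReal}
    {b : β} {c : γ} (h : ∀ a ∈ p.support, t * F a b ≤ G a c) :
    t * (p.bind F) b ≤ (p.bind G) c := by
  rw [PMF.bind_apply, PMF.bind_apply, ← ENNReal.tsum_mul_left]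
  refine ENNReal.tsum_le_tsum fun a => ?_
  by_cases ha : a ∈ p.support
  · rw [mul_left_comm]
    exact mul_le_mul_right (h a ha) _
  · simp [(PMF.apply_eq_zero_iff p a).2 ha]

/-! ### Negligible functions -/

/-- All coefficients are natural numbers, and `p.eval 1` is their sum. -/
theorem eval_le_eval_one_mul_pow (p : Polynomial ℕ) {n : ℕ} (hn : 0 < n) :
    p.eval n ≤ p.eval 1 * n ^ p.natDegree := by
  rw [Polynomial.eval_eq_sum_range, Polynomial.eval_eq_sum_range, Finset.sum_mul]
  refine Finset.sum_le_sum fun i hi => ?_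
  rw [one_pow, mul_one]
  exact Nat.mul_le_mul_left _ (Nat.pow_le_pow_right hn (by
    rw [Finset.mem_range] at hi
    omega))

theorem Negligible.of_le_mul {μ ν : ℕ → ℝ} (hμ : Negligible μ) (p : Polynomial ℕ)
    (h0 : ∀ n, 0 ≤ ν n) (h : ∀ n, ν n ≤ ((p.eval n : ℕ) : ℝ) * μ n) : Negligible ν := by
  refine ⟨h0, fun c hc => ?_⟩
  -- The degree absorbs the power of `n` in the bound for `p`; one more power absorbs the constant
  -- `p.eval 1 + 1`, which is at most `n` for large `n`.
  obtain ⟨N, hN, hμN⟩ := hμ.2 (c + p.natDegree + 1) (by omega)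
  refine ⟨N + p.eval 1 + 1, by omega, fun n hn => (h n).trans_lt ?_⟩
  have hn0 : 0 < n := by omega
  have hnR : (0 : ℝ) < n := by exact_mod_cast hn0
  have h1 := hμN n (by omega)
  have h2 : ((p.eval n : ℕ) : ℝ) ≤ ((p.eval 1 : ℕ) + 1) * (n : ℝ) ^ p.natDegree := by
    have h3 : ((p.eval n : ℕ) : ℝ) ≤ (p.eval 1 : ℕ) * (n : ℝ) ^ p.natDegree := by
      exact_mod_cast eval_le_eval_one_mul_pow p hn0
    have : (0 : ℝ) ≤ (n : ℝ) ^ p.natDegree := by positivity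
    linarith
  have h3 : ((p.eval 1 : ℕ) : ℝ) + 1 ≤ n := by
    exact_mod_cast (show p.eval 1 + 1 ≤ n by omega)
  calc ((p.eval n : ℕ) : ℝ) * μ n ≤ ((p.eval 1 : ℕ) + 1) * (n : ℝ) ^ p.natDegree * μ n :=
        mul_le_mul_of_nonneg_right h2 (hμ.1 n)
    _ ≤ n * (n : ℝ) ^ p.natDegree * μ n := by
        refine mul_le_mul_of_nonneg_right ?_ (hμ.1 n)
        exact mul_le_mul_of_nonneg_right h3 (by positivity)
    _ < n * (n : ℝ) ^ p.natDegree * (1 / (n : ℝ) ^ (c + p.natDegree + 1)) :=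
        mul_lt_mul_of_pos_left h1 (by positivity)
    _ = 1 / (n : ℝ) ^ c := by
        field_simp
        ring

theorem Negligible.add {μ ν : ℕ → ℝ} (hμ : Negligible μ) (hν : Negligible ν) :
    Negligible fun n => μ n + ν n := by
  refine ⟨fun n => add_nonneg (hμ.1 n) (hν.1 n), fun c hc => ?_⟩
  -- The additional power of `n ≥ 2` pays for having two summands.
  obtain ⟨N, hN, h1⟩ := hμ.2 (c + 1) (by omega)
  obtain ⟨M, hM, h2⟩ := hν.2 (c + 1) (by omega)
  refine ⟨N + M + 2, by omega, fun n hn => ?_⟩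
  have h3 := h1 n (by omega)
  have h4 := h2 n (by omega)
  have hn2 : (2 : ℝ) ≤ n := by exact_mod_cast (show 2 ≤ n by omega)
  have h5 : 2 * (1 / (n : ℝ) ^ (c + 1)) ≤ 1 / (n : ℝ) ^ c := by
    rw [pow_succ, mul_one_div, div_le_div_iff₀ (by positivity) (by positivity)]
    have : (0 : ℝ) < (n : ℝ) ^ c := by positivity
    nlinarith
  linarith

/-! ### Encryption bit by bit -/

namespace PKE

variable (E : PKE) (bit : ℕ → Bool → Data)

/-- Encrypt one bit and add the ciphertext to a list. -/
def encStep (n : ℕ) (pk a acc : Data) : PMF Data :=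
  (E.enc n pk (bit n a.toBit)).bind fun c => PMF.pure (node c acc)

theorem encList_append (n : ℕ) (pk : Data) (l₁ l₂ : List Data) :
    E.encList n pk (l₁ ++ l₂) = (E.encList n pk l₁).bind fun v₁ =>
      (E.encList n pk l₂).bind fun v₂ => PMF.pure (v₁.append v₂) := by
  induction l₁ with
  | nil => simp [encList, pure_eq, Data.append]
  | cons a l ih =>
    simp only [List.cons_append, encList, ih, bind_eq, pure_eq, PMF.bind_bind, PMF.pure_bind,
      Data.append]

/-- Each ciphertext is put in front of the accumulator, so folding over the reversed list restores
the order. The encryptions are drawn in the opposite order to `encList`, which is immaterial since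
they are independent. -/
theorem foldData_encStep (n : ℕ) (pk : Data) (l : List Data) (acc : Data) :
    foldData (E.encStep bit n pk) l.reverse acc =
      (E.encList n pk (l.map fun a => bit n a.toBit)).bind fun v => PMF.pure (v.append acc) := by
  induction l with
  | nil => simp [foldData, encList, pure_eq, Data.append]
  | cons a l ih =>
    rw [List.reverse_cons, foldData_append, ih]
    simp only [List.map_cons, encList, bind_eq, pure_eq, PMF.bind_bind, PMF.pure_bind, foldData,
      encStep, Data.append]
    rw [PMF.bind_comm]

variable {bit}

theorem isPoly_bit (hbit : ∀ b, IsPolyTime fun n _ => bit n b) {F : ℕ → Data → Data}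
    (hF : IsPoly F) : IsPoly fun n x => bit n (F n x).toBit := by
  have h := IsPoly.ite hF (hbit true).isPoly (hbit false).isPoly
  have e : (fun n x => bit n (F n x).toBit) =
      fun n x => if (F n x).toBit then bit n true else bit n false := by
    funext n x
    cases (F n x).toBit <;> rfl
  rwa [e]

theorem isPPT_foldData_encStep (hbit : ∀ b, IsPolyTime fun n _ => bit n b) :
    IsPPT fun n x => foldData (E.encStep bit n x.fst) x.snd.fst.toList x.snd.snd := by
  have hG : IsPPT fun n x => E.encStep bit n x.fst x.snd.fst x.snd.snd :=
    IsPPT.bind' (E.enc_ppt.subst (F := fun n x => node x.fst (bit n x.snd.fst.toBit))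
      (IsPoly.id.fst.node (isPoly_bit hbit IsPoly.id.snd.fst)))
      (IsPoly.id.snd.node IsPoly.id.fst.snd.snd)
  -- The new ciphertext does not depend on the accumulator, so its size can be read off from the
  -- case of an empty one.
  obtain ⟨p, hp⟩ := IsPPT.size_le (hG.subst (F := fun n x => node x.fst (node x.snd Data.nil))
    (IsPoly.id.fst.node (IsPoly.id.snd.node IsPoly.nil)))
  refine IsPPT.foldData hG (p.comp (Polynomial.X + 1) + 1) fun n c a acc z hz => ?_
  simp only [encStep, PMF.mem_support_bind_iff, PMF.support_pure, Set.mem_singleton_iff] at hz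
  obtain ⟨w, hw, rfl⟩ := hz
  have h := hp n (node c a) (node w Data.nil) (by
    simp only [encStep, PMF.mem_support_bind_iff, PMF.support_pure, Set.mem_singleton_iff]
    exact ⟨w, hw, rfl⟩)
  simp only [Data.size, Polynomial.eval_add, Polynomial.eval_comp, Polynomial.eval_X,
    Polynomial.eval_one] at h ⊢
  rw [show n + c.size + a.size + 1 = n + (c.size + a.size + 1) by ring]
  omega

variable (bit)

/-- Encryption of the bits of a bit string. -/
def encBits (n : ℕ) (pk w : Data) : PMF Data := E.encList n pk (w.toBits.map (bit n))

theorem encBits_eq (n : ℕ) (pk w : Data) :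
    E.encBits bit n pk w = foldData (E.encStep bit n pk) w.toList.reverse Data.nil := by
  simp [foldData_encStep, Data.append_nil, encBits, toBits, Function.comp_def]

variable {bit}

theorem isPPT_encBits (hbit : ∀ b, IsPolyTime fun n _ => bit n b) :
    IsPPT fun n x => E.encBits bit n x.fst x.snd := by
  have h := (E.isPPT_foldData_encStep hbit).subst
    (F := fun _ x => node x.fst (node (revAppend x.snd Data.nil) Data.nil))
    (IsPoly.id.fst.node ((isPoly_revAppend IsPoly.id.snd IsPoly.nil).node IsPoly.nil))
  simp only [encBits_eq]
  simpa [revAppend, Data.toList] using h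

variable {E}

/-! ### Security of the encryption of many messages -/

/-- The success probability in the IND-CPA experiment, in terms of the two values of the bit. -/
theorem advantage_eq (K : ℕ → PMF (Data × Data)) (A : Adversary) (n : ℕ) :
    prob (E.experiment K A n) true - prob (E.experiment K A n) false =
      prob ((K n).bind fun k => (A.choose n k.2).bind fun r =>
        (E.enc n k.1 r.snd.fst).bind fun c => (A.guess n (node r.snd.snd c)).bind fun d =>
          PMF.pure d.toBit) true -
      prob ((K n).bind fun k => (A.choose n k.2).bind fun r =>
        (E.enc n k.1 r.fst).bind fun c => (A.guess n (node r.snd.snd c)).bind fun d =>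
          PMF.pure d.toBit) true := by
  have h := prob_guess ((K n).bind fun k => (A.choose n k.2).bind fun r => PMF.pure (k.1, r))
    fun a b => (E.enc n a.1 (if b then a.2.snd.fst else a.2.fst)).bind fun c =>
      (A.guess n (node a.2.snd.snd c)).bind fun d => PMF.pure d.toBit
  simp only [PMF.bind_bind, PMF.pure_bind, if_true, Bool.false_eq_true, if_false] at h
  simpa only [experiment, bind_eq, pure_eq] using h

variable (bit)

/-- The challenge messages at a position in the lists of bits `s.fst` and `s.snd.fst`, and the
state that is needed later on. -/
def hybridChoice (n : ℕ) (pk s r : Data) : Data :=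
  node (bit n (moveFirst^[r.size] (node Data.nil s.fst)).snd.fst.toBit)
    (node (bit n (moveFirst^[r.size] (node Data.nil s.snd.fst)).snd.fst.toBit)
      (node pk (node (moveFirst^[r.size] (node Data.nil s.snd.fst)).fst
        (node (moveFirst^[r.size] (node Data.nil s.fst)).snd.snd s.snd.snd))))

theorem isPoly_hybridChoice (hbit : ∀ b, IsPolyTime fun n _ => bit n b) :
    IsPoly fun n x => hybridChoice bit n x.fst x.snd.fst x.snd.snd := by
  have h0 : IsPoly fun n x => moveFirst^[x.snd.snd.size] (node Data.nil x.snd.fst.fst) :=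
    isPoly_moveFirst_iterate IsPoly.id.snd.snd (IsPoly.nil.node IsPoly.id.snd.fst.fst)
  have h1 : IsPoly fun n x => moveFirst^[x.snd.snd.size] (node Data.nil x.snd.fst.snd.fst) :=
    isPoly_moveFirst_iterate IsPoly.id.snd.snd (IsPoly.nil.node IsPoly.id.snd.fst.snd.fst)
  exact (isPoly_bit hbit h0.snd.fst).node ((isPoly_bit hbit h1.snd.fst).node
    (IsPoly.id.fst.node (h1.fst.node (h0.snd.snd.node IsPoly.id.snd.fst.snd.snd))))

variable (E)

/-- Complete a challenge ciphertext to a hybrid list of ciphertexts and run a distinguisher. -/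
def hybridGuess (D : ℕ → Data → PMF Data) (n : ℕ) (y : Data) : PMF Data :=
  (E.encBits bit n y.fst.fst y.fst.snd.snd.fst).bind fun v =>
    (foldData (E.encStep bit n y.fst.fst) y.fst.snd.fst.toList (node y.snd v)).bind fun w =>
      D n (node y.fst.snd.snd.snd (node y.fst.fst w))

theorem isPPT_hybridGuess (hbit : ∀ b, IsPolyTime fun n _ => bit n b) {D : ℕ → Data → PMF Data}
    (hD : IsPPT D) : IsPPT (E.hybridGuess bit D) := by
  refine IsPPT.bind' ((E.isPPT_encBits hbit).subst
    (F := fun _ y => node y.fst.fst y.fst.snd.snd.fst)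
    (IsPoly.id.fst.fst.node IsPoly.id.fst.snd.snd.fst)) ?_
  refine IsPPT.bind' ((E.isPPT_foldData_encStep hbit).subst
    (F := fun _ y => node y.fst.fst.fst (node y.fst.fst.snd.fst (node y.fst.snd y.snd)))
    (IsPoly.id.fst.fst.fst.node (IsPoly.id.fst.fst.snd.fst.node
      (IsPoly.id.fst.snd.node IsPoly.id.snd)))) ?_
  exact hD.subst (IsPoly.id.fst.fst.fst.snd.snd.snd.node
    (IsPoly.id.fst.fst.fst.fst.node IsPoly.id.snd))

variable {bit}

/-- The adversary that distinguishes two neighbouring hybrids at a random position. -/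
def hybridAdversary (hbit : ∀ b, IsPolyTime fun n _ => bit n b) {S : ℕ → PMF Data}
    (hS : IsPPT fun n _ => S n) {D : ℕ → Data → PMF Data} (hD : IsPPT D) : Adversary where
  choose n pk := (S n).bind fun s => (randomIndex s.fst).bind fun r =>
    PMF.pure (hybridChoice bit n pk s r)
  guess := E.hybridGuess bit D
  choose_ppt := by
    refine IsPPT.bind' hS (IsPPT.bind' (isPPT_randomIndex.subst IsPoly.id.snd.fst) ?_)
    exact (isPoly_hybridChoice bit hbit).subst
      (F := fun _ y => node y.fst.fst (node y.fst.snd y.snd))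
      (IsPoly.id.fst.fst.node (IsPoly.id.fst.snd.node IsPoly.id.snd))
  guess_ppt := E.isPPT_hybridGuess bit hbit hD

variable (bit)

/-- Run a distinguisher on encryptions of the messages in a list. -/
def distinguish (D : ℕ → Data → PMF Data) (n : ℕ) (pk st : Data) (l : List Data) : PMF Bool :=
  (E.encList n pk (l.map fun a => bit n a.toBit)).bind fun v =>
    (D n (node st (node pk v))).bind fun d => PMF.pure d.toBit

/-- The challenge is drawn before the rest and the front part, which is stored in reverse as
`moveFirst` leaves it. By independence the list of ciphertexts is distributed as one encrypted from
left to right. -/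
theorem hybridGuess_eq (D : ℕ → Data → PMF Data) (n : ℕ) (pk st a : Data) (f b : List Data) :
    ((E.enc n pk (bit n a.toBit)).bind fun c =>
      (E.hybridGuess bit D n (node (node pk (node (ofList f.reverse)
        (node (ofList b) st))) c)).bind fun d => PMF.pure d.toBit) =
      E.distinguish bit D n pk st (f ++ a :: b) := by
  simp only [hybridGuess, distinguish, fst_node, snd_node, encBits, toBits, Data.toList_ofList,
    foldData_encStep, List.map_append, List.map_cons, List.map_map, encList_append, encList,
    bind_eq, pure_eq, PMF.bind_bind, PMF.pure_bind, Function.comp_def]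
  have h : ∀ {α β γ δ : Type} (p : PMF α) (q : PMF β) (r : PMF γ) (F : α → β → γ → PMF δ),
      (p.bind fun a => q.bind fun b => r.bind fun c => F a b c) =
        r.bind fun c => p.bind fun a => q.bind fun b => F a b c := by
    intro α β γ δ p q r F
    rw [PMF.bind_comm r]
    congr 1
    funext a
    exact PMF.bind_comm _ _ _
  exact h _ _ _ _

variable {bit E}

/-- Hybrid `i` takes its first `i` bits from the second string and the others from the first. The
left challenge message at position `i` produces hybrid `i`, the right one hybrid `i + 1`. -/
theorem hybridChoice_left (D : ℕ → Data → PMF Data) (n : ℕ) (pk s : Data) (i : ℕ)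
    (h0 : i < s.fst.toList.length) (h1 : i ≤ s.snd.fst.toList.length) :
    ((E.enc n pk (hybridChoice bit n pk s (unary i)).fst).bind fun c =>
      (E.hybridGuess bit D n (node (hybridChoice bit n pk s (unary i)).snd.snd c)).bind fun d =>
        PMF.pure d.toBit) =
      E.distinguish bit D n pk s.snd.snd (s.snd.fst.toList.take i ++ s.fst.toList.drop i) := by
  have e0 := moveFirst_iterate i [] s.fst.toList h0.le
  have e1 := moveFirst_iterate i [] s.snd.fst.toList h1
  simp only [Data.ofList_toList, List.append_nil, ofList] at e0 e1
  rw [List.drop_eq_getElem_cons h0, ← hybridGuess_eq]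
  simp only [hybridChoice, Data.size_unary, e0, e1, fst_node, snd_node,
    List.drop_eq_getElem_cons h0, ofList]

theorem hybridChoice_right (D : ℕ → Data → PMF Data) (n : ℕ) (pk s : Data) (i : ℕ)
    (h0 : i < s.fst.toList.length) (h1 : i < s.snd.fst.toList.length) :
    ((E.enc n pk (hybridChoice bit n pk s (unary i)).snd.fst).bind fun c =>
      (E.hybridGuess bit D n (node (hybridChoice bit n pk s (unary i)).snd.snd c)).bind fun d =>
        PMF.pure d.toBit) =
      E.distinguish bit D n pk s.snd.snd
        (s.snd.fst.toList.take (i + 1) ++ s.fst.toList.drop (i + 1)) := by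
  have e0 := moveFirst_iterate i [] s.fst.toList h0.le
  have e1 := moveFirst_iterate i [] s.snd.fst.toList h1.le
  simp only [Data.ofList_toList, List.append_nil, ofList] at e0 e1
  rw [List.take_succ_eq_append_getElem h1, List.append_assoc, List.singleton_append,
    ← hybridGuess_eq]
  simp only [hybridChoice, Data.size_unary, e0, e1, fst_node, snd_node,
    List.drop_eq_getElem_cons h0, List.drop_eq_getElem_cons h1, ofList]

/-- Past the end both positions read `nil`, which is the bit `0`. The challenge then reveals
nothing, so an index range longer than the lists is harmless. -/
theorem hybridChoice_fst_eq (n : ℕ) (pk s : Data) (i : ℕ)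
    (h0 : s.fst.toList.length ≤ i) (h1 : s.snd.fst.toList.length ≤ i) :
    (hybridChoice bit n pk s (unary i)).fst = (hybridChoice bit n pk s (unary i)).snd.fst := by
  have e : ∀ w : Data, w.toList.length ≤ i →
      (moveFirst^[i] (node Data.nil w)).snd = Data.nil := by
    intro w hw
    rw [snd_moveFirst_iterate, snd_node, ← Data.ofList_toList w, Data.snd_iterate_ofList,
      List.drop_eq_nil_of_le (by simpa using hw)]
    rfl
  simp only [hybridChoice, Data.size_unary, fst_node, snd_node, e _ h0, e _ h1]

/-- The range of the index depends only on the length of the list, which is constant on the support;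
therefore averaging over `p` commutes with the sum over positions. -/
theorem bind_randomIndex_apply {α : Type} {p : PMF α} {w : α → Data} {L : ℕ}
    (hw : ∀ a ∈ p.support, (w a).toList.length = L) (F : α → Data → PMF Bool) :
    (indexRange L : ℝ) * prob (p.bind fun a => (randomIndex (w a)).bind (F a)) true =
      ∑ i ∈ Finset.range (indexRange L), prob (p.bind fun a => F a (unary i)) true := by
  have h : (p.bind fun a => (randomIndex (w a)).bind (F a)) true * indexRange L =
      ∑ i ∈ Finset.range (indexRange L), (p.bind fun a => F a (unary i)) true := by
    simp only [PMF.bind_apply p]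
    rw [← ENNReal.tsum_mul_right, ← Summable.tsum_finsetSum fun _ _ => ENNReal.summable]
    refine tsum_congr fun a => ?_
    by_cases ha : a ∈ p.support
    · rw [mul_assoc, ← hw a ha, randomIndex_bind_apply, Finset.mul_sum]
    · simp [(PMF.apply_eq_zero_iff p a).2 ha]
  have h' := congrArg ENNReal.toReal h
  rw [ENNReal.toReal_mul, ENNReal.toReal_sum fun _ _ => PMF.apply_ne_top _ _,
    ENNReal.toReal_natCast] at h'
  rw [mul_comm]
  exact h'

/-- A secure scheme hides bit strings that are encrypted bit by bit. Here `S` samples two bit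
strings `s.fst`, `s.snd.fst` and further information `s.snd.snd`. -/
theorem Secure.distinguish_negligible (hE : E.Secure) (hbit : ∀ b, IsPolyTime fun n _ => bit n b)
    (hmem : ∀ n b, bit n b ∈ E.msg n) {S : ℕ → PMF Data} (hS : IsPPT fun n _ => S n) {L : ℕ → ℕ}
    (hL : ∀ n, ∀ s ∈ (S n).support,
      s.fst.toList.length = L n ∧ s.snd.fst.toList.length = L n)
    {p : Polynomial ℕ} (hp : ∀ n, L n ≤ p.eval n) {D : ℕ → Data → PMF Data} (hD : IsPPT D) :
    Negligible fun n =>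
      |prob ((E.skGen n).bind fun sk => (E.pkGen n sk).bind fun pk => (S n).bind fun s =>
          E.distinguish bit D n pk s.snd.snd s.snd.fst.toList) true -
        prob ((E.skGen n).bind fun sk => (E.pkGen n sk).bind fun pk => (S n).bind fun s =>
          E.distinguish bit D n pk s.snd.snd s.fst.toList) true| := by
  set B : Adversary := E.hybridAdversary hbit hS hD with hB
  have hBv : B.ValidFor E.msg := by
    intro n z r hr
    simp only [hB, hybridAdversary, PMF.mem_support_bind_iff, PMF.support_pure,
      Set.mem_singleton_iff] at hr
    obtain ⟨s, -, i, -, rfl⟩ := hr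
    exact ⟨hmem _ _, hmem _ _⟩
  -- The loss of the hybrid argument is the number of possible positions, `indexRange (L n) ≤ 2 * L
  -- n + 1`.
  refine Negligible.of_le_mul (hE B hBv) (2 * p + 1) (fun n => abs_nonneg _) fun n => ?_
  rw [advantage_eq]
  let P : PMF (Data × Data) := (E.skGen n).bind fun sk => (E.pkGen n sk).bind fun pk =>
    (S n).bind fun s => PMF.pure (pk, s)
  have hP : ∀ a ∈ P.support, a.2.fst.toList.length = L n ∧ a.2.snd.fst.toList.length = L n := by
    intro a ha
    simp only [P, PMF.mem_support_bind_iff, PMF.support_pure, Set.mem_singleton_iff] at ha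
    obtain ⟨sk, -, pk, -, s, hs, rfl⟩ := ha
    exact hL n s hs
  let H : ℕ → ℝ := fun i => prob (P.bind fun a => E.distinguish bit D n a.1 a.2.snd.snd
    (a.2.snd.fst.toList.take i ++ a.2.fst.toList.drop i)) true
  let T : (Data → Data) → Data × Data → Data → PMF Bool := fun m a r =>
    (E.enc n a.1 (m (hybridChoice bit n a.1 a.2 r))).bind fun c => (E.hybridGuess bit D n
      (node (hybridChoice bit n a.1 a.2 r).snd.snd c)).bind fun d => PMF.pure d.toBit
  have h1 := bind_randomIndex_apply (fun a ha => (hP a ha).1) (T fun r => r.snd.fst)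
  have h0 := bind_randomIndex_apply (fun a ha => (hP a ha).1) (T Data.fst)
  have hsum : ∑ i ∈ Finset.range (indexRange (L n)),
      (prob (P.bind fun a => T (fun r => r.snd.fst) a (unary i)) true -
        prob (P.bind fun a => T Data.fst a (unary i)) true) = H (L n) - H 0 := by
    -- Positions below `L n` telescope from hybrid `0` to hybrid `L n`; each of the others
    -- contributes zero.
    rw [← Finset.sum_range_sub, ← Finset.sum_subset
      (Finset.range_subset_range.2 (le_indexRange (L n)))]
    · refine Finset.sum_congr rfl fun i hi => ?_
      rw [Finset.mem_range] at hi
      congr 2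
      · refine bind_congr_support fun a ha => ?_
        obtain ⟨h0, h1⟩ := hP a ha
        exact hybridChoice_right D n a.1 a.2 i (by omega) (by omega)
      · refine bind_congr_support fun a ha => ?_
        obtain ⟨h0, h1⟩ := hP a ha
        exact hybridChoice_left D n a.1 a.2 i (by omega) (by omega)
    · intro i _ hi
      rw [Finset.mem_range] at hi
      rw [sub_eq_zero]
      congr 1
      refine bind_congr_support fun a ha => ?_
      obtain ⟨h0, h1⟩ := hP a ha
      simp only [T]
      rw [hybridChoice_fst_eq n a.1 a.2 i (by omega) (by omega)]
  rw [Finset.sum_sub_distrib, ← h1, ← h0, ← mul_sub] at hsum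
  have e1 : H (L n) = prob ((E.skGen n).bind fun sk => (E.pkGen n sk).bind fun pk =>
      (S n).bind fun s => E.distinguish bit D n pk s.snd.snd s.snd.fst.toList) true := by
    have : H (L n) = prob (P.bind fun a => E.distinguish bit D n a.1 a.2.snd.snd
        a.2.snd.fst.toList) true := by
      simp only [H]
      congr 1
      refine bind_congr_support fun a ha => ?_
      obtain ⟨h0, h1⟩ := hP a ha
      rw [List.take_of_length_le h1.le, List.drop_eq_nil_of_le h0.le, List.append_nil]
    rw [this]
    simp only [P, PMF.bind_bind, PMF.pure_bind]
  have e0 : H 0 = prob ((E.skGen n).bind fun sk => (E.pkGen n sk).bind fun pk =>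
      (S n).bind fun s => E.distinguish bit D n pk s.snd.snd s.fst.toList) true := by
    simp only [H, P, PMF.bind_bind, PMF.pure_bind, List.take_zero, List.drop_zero,
      List.nil_append]
  rw [← e1, ← e0, ← hsum, abs_mul, Nat.abs_cast]
  have hle : ((indexRange (L n) : ℕ) : ℝ) ≤ ((2 * p + 1 : Polynomial ℕ).eval n : ℕ) := by
    have h2 := indexRange_le (L n)
    have h3 := hp n
    have : indexRange (L n) ≤ (2 * p + 1 : Polynomial ℕ).eval n := by
      simp only [Polynomial.eval_add, Polynomial.eval_mul, Polynomial.eval_ofNat,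
        Polynomial.eval_one]
      omega
    exact_mod_cast this
  refine mul_le_mul hle (le_of_eq ?_) (abs_nonneg _) (Nat.cast_nonneg _)
  simp only [P, T, hB, hybridAdversary, bind_eq, pure_eq, PMF.bind_bind, PMF.pure_bind]

end PKE

/-! ### Averaging over keys, and the IND-CPA game as an algorithm -/

theorem le_bind_apply {α β : Type} {p : PMF α} {G : α → PMF β} {t : ENNReal} {b : β}
    (h : ∀ a ∈ p.support, t ≤ G a b) : t ≤ (p.bind G) b := by
  have := mul_bind_apply_le (p := p) (F := fun _ => PMF.pure b) (b := b) (G := G) (c := b) (t := t)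
    fun a ha => by simpa using h a ha
  simpa using this

theorem bind_comm₂ {α β γ δ : Type} (p : PMF α) (q : α → PMF β) (r : PMF γ)
    (F : α → β → γ → PMF δ) :
    (p.bind fun a => (q a).bind fun b => r.bind fun c => F a b c) =
      r.bind fun c => p.bind fun a => (q a).bind fun b => F a b c := by
  rw [PMF.bind_comm r]
  congr 1
  funext a
  exact PMF.bind_comm _ _ _

/-- The part of the IND-CPA experiment that follows the generation of the keys. -/
def PKE.guessGame (E : PKE) (A : Adversary) (n : ℕ) (pk z : Data) : PMF Bool :=
  (A.choose n z).bind fun r => (PMF.uniformOfFintype Bool).bind fun b =>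
    (E.enc n pk (if b then r.snd.fst else r.fst)).bind fun c =>
      (A.guess n (node r.snd.snd c)).bind fun d => PMF.pure (d.toBit == b)

/-- This is what allows a distinguisher against `H` to play the complete game for `E₁` by itself and
to report whether the adversary won. -/
theorem PKE.isPPT_guessGame (E : PKE) (A : Adversary) :
    IsPPT fun n x => (E.guessGame A n x.fst x.snd).map ofBit := by
  have hb : IsPoly fun (_ : ℕ) (x : Data) => if x.fst.toBit then (if x.snd.toBit then ofBit true else
      ofBit false) else if x.snd.toBit then ofBit false else ofBit true :=
    have h1 : IsPoly fun _ _ => ofBit true := IsPoly.nil.node IsPoly.nil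
    have h0 : IsPoly fun _ _ => ofBit false := IsPoly.nil
    IsPoly.ite IsPoly.id.fst (IsPoly.ite IsPoly.id.snd h1 h0) (IsPoly.ite IsPoly.id.snd h0 h1)
  have h : IsPPT fun n x => (A.choose n x.snd).bind fun r =>
      ((PMF.uniformOfFintype Bool).map ofBit).bind fun b =>
        (E.enc n x.fst (if b.toBit then r.snd.fst else r.fst)).bind fun c =>
          (A.guess n (node r.snd.snd c)).bind fun d => PMF.pure (if d.toBit then
            (if b.toBit then ofBit true else ofBit false) else
              if b.toBit then ofBit false else ofBit true) := by
    refine IsPPT.bind' (A.choose_ppt.subst IsPoly.id.snd) (IsPPT.bind' IsPPT.coin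
      (IsPPT.bind' (E.enc_ppt.subst (F := fun _ y => node y.fst.fst.fst
        (if y.snd.toBit then y.fst.snd.snd.fst else y.fst.snd.fst)) ?_)
        (IsPPT.bind' (A.guess_ppt.subst (IsPoly.id.fst.fst.snd.snd.snd.node IsPoly.id.snd)) ?_)))
    · exact IsPoly.id.fst.fst.fst.node
        (IsPoly.ite IsPoly.id.snd IsPoly.id.fst.snd.snd.fst IsPoly.id.fst.snd.fst)
    · exact hb.subst (IsPoly.id.snd.node IsPoly.id.fst.fst.snd)
  have e : ∀ d b : Bool, (if d then (if b then ofBit true else ofBit false) else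
      if b then ofBit false else ofBit true) = ofBit (d == b) := by
    intro d b
    cases d <;> cases b <;> rfl
  simp only [PMF.bind_map, Function.comp_def, Data.toBit_ofBit, e] at h
  simp only [PKE.guessGame, PMF.map_bind, PMF.pure_map]
  exact h

theorem PKE.experiment_eq (E : PKE) (K : ℕ → PMF (Data × Data)) (A : Adversary) (n : ℕ) :
    E.experiment K A n = (K n).bind fun k => E.guessGame A n k.1 k.2 := rfl

theorem prob_true_sub_false (p : PMF Bool) : prob p true - prob p false = 2 * prob p true - 1 := by
  have := prob_true_add_false p
  linarith

/-! ### Composition of arbitrary bridges -/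

namespace PreBridge

variable {E₁ E₂ E₃ : PKE}

theorem mem_support_keyGen {f : PreBridge E₁ E₂} {n : ℕ} {k : BridgeKeys} :
    k ∈ (f.keyGen n).support ↔ k.sk₁ ∈ (E₁.skGen n).support ∧
      k.pk₁ ∈ (E₁.pkGen n k.sk₁).support ∧ ∃ s ∈ (f.skStage n k.sk₁).support, s.fst = k.sk₂ ∧
        k.pk₂ ∈ (E₂.pkGen n k.sk₂).support ∧
        k.bk ∈ (f.bkStage n k.sk₁ k.pk₁ k.sk₂ k.pk₂ s.snd).support := by
  simp only [keyGen, bind_eq, pure_eq, PMF.mem_support_bind_iff, PMF.support_pure,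
    Set.mem_singleton_iff]
  constructor
  · rintro ⟨sk₁, h1, pk₁, h2, s, h3, pk₂, h4, bk, h5, rfl⟩
    exact ⟨h1, h2, s, h3, rfl, h4, h5⟩
  · rintro ⟨h1, h2, s, h3, h, h4, h5⟩
    refine ⟨k.sk₁, h1, k.pk₁, h2, s, h3, k.pk₂, h ▸ h4, k.bk, ?_, ?_⟩
    · rw [h]
      exact h5
    · rw [h]

/-- The key `sk₂` made by `f` need not be distributed as by the key generation of `E₂`, but it lies
in its support. This suffices for every condition on `g` that is imposed for all keys. -/
theorem IsBridge.sk₂_mem {f : PreBridge E₁ E₂} (hf : f.IsBridge) {n : ℕ} {k : BridgeKeys}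
    (hk : k ∈ (f.keyGen n).support) : k.sk₂ ∈ (E₂.skGen n).support := by
  obtain ⟨h1, -, s, hs, h, -⟩ := mem_support_keyGen.1 hk
  exact h ▸ hf.skStage_mem n _ h1 s hs

theorem comp_skStage_ppt {f : PreBridge E₁ E₂} (hf : f.IsBridge) {g : PreBridge E₂ E₃}
    (hg : g.IsBridge) : IsPPT (g.comp f).skStage := by
  refine IsPPT.bind' hf.skStage_ppt (IsPPT.bind' (hg.skStage_ppt.subst IsPoly.id.snd.fst) ?_)
  exact IsPoly.id.snd.fst.node (IsPoly.id.fst.snd.node IsPoly.id.snd.snd)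

theorem comp_bkStage_ppt {f : PreBridge E₁ E₂} (hf : f.IsBridge) {g : PreBridge E₂ E₃}
    (hg : g.IsBridge) : IsPPT fun n x => (g.comp f).bkStage n x.fst x.snd.fst x.snd.snd.fst
      x.snd.snd.snd.fst x.snd.snd.snd.snd := by
  refine IsPPT.bind' (E₂.pkGen_ppt.subst IsPoly.id.snd.snd.snd.snd.fst.fst) ?_
  have i : IsPoly fun _ x => x.fst := IsPoly.id.fst
  refine IsPPT.bind' (hf.bkStage_ppt.subst (F := fun _ x => node x.fst.fst (node x.fst.snd.fst
    (node x.fst.snd.snd.snd.snd.fst.fst (node x.snd x.fst.snd.snd.snd.snd.fst.snd))))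
    (i.fst.node (i.snd.fst.node (i.snd.snd.snd.snd.fst.fst.node
      (IsPoly.id.snd.node i.snd.snd.snd.snd.fst.snd))))) ?_
  refine IsPPT.bind' (hg.bkStage_ppt.subst (F := fun _ x =>
    node x.fst.fst.snd.snd.snd.snd.fst.fst (node x.fst.snd (node x.fst.fst.snd.snd.fst
      (node x.fst.fst.snd.snd.snd.fst x.fst.fst.snd.snd.snd.snd.snd))))
    (i.fst.snd.snd.snd.snd.fst.fst.node (i.snd.node (i.fst.snd.snd.fst.node
      (i.fst.snd.snd.snd.fst.node i.fst.snd.snd.snd.snd.snd))))) ?_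
  exact i.snd.node (i.fst.snd.node IsPoly.id.snd)

theorem comp_apply_ppt {f : PreBridge E₁ E₂} (hf : f.IsBridge) {g : PreBridge E₂ E₃}
    (hg : g.IsBridge) : IsPPT fun n x => (g.comp f).apply n x.fst x.snd := by
  refine IsPPT.bind' (hf.apply_ppt.subst (F := fun _ x => node x.fst.fst x.snd)
    (IsPoly.id.fst.fst.node IsPoly.id.snd)) ?_
  exact hg.apply_ppt.subst (F := fun _ x => node x.fst.fst.snd.snd x.snd)
    (IsPoly.id.fst.fst.snd.snd.node IsPoly.id.snd)

theorem comp_skStage_mem {f : PreBridge E₁ E₂} (hf : f.IsBridge) {g : PreBridge E₂ E₃}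
    (hg : g.IsBridge) (n : ℕ) : ∀ sk₁ ∈ (E₁.skGen n).support,
    ∀ s ∈ ((g.comp f).skStage n sk₁).support, s.fst ∈ (E₃.skGen n).support := by
  intro sk₁ h1 s hs
  simp only [comp, bind_eq, pure_eq, PMF.mem_support_bind_iff, PMF.support_pure,
    Set.mem_singleton_iff] at hs
  obtain ⟨u, hu, t, ht, rfl⟩ := hs
  exact hg.skStage_mem n _ (hf.skStage_mem n _ h1 u hu) t ht

theorem comp_apply_mem {f : PreBridge E₁ E₂} (hf : f.IsBridge) {g : PreBridge E₂ E₃}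
    (hg : g.IsBridge) (n : ℕ) : ∀ k ∈ ((g.comp f).keyGen n).support, ∀ c ∈ E₁.ct n,
    ∀ c' ∈ ((g.comp f).apply n k.bk c).support, c' ∈ E₃.ct n := by
  intro k hk c hc c' hc'
  simp only [keyGen_comp, bind_eq, pure_eq, PMF.mem_support_bind_iff, PMF.support_pure,
    Set.mem_singleton_iff] at hk
  obtain ⟨l, hl, t, ht, pk₃, hpk₃, bkg, hbkg, rfl⟩ := hk
  simp only [comp, bind_eq, PMF.mem_support_bind_iff, fst_node, snd_node] at hc'
  obtain ⟨c₂, hc₂, hc'⟩ := hc'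
  obtain ⟨-, -, -, -, -, h2, -⟩ := mem_support_keyGen.1 hl
  -- The keys of `E₂` made by `f`, continued by the later stages of `g`, are a possible outcome of
  -- the key generation of `g`.
  exact hg.apply_mem n ⟨l.sk₂, l.pk₂, t.fst, pk₃, bkg⟩
    (mem_support_keyGen.2 ⟨hf.sk₂_mem hl, h2, t, ht, rfl, hpk₃, hbkg⟩) c₂
    (hf.apply_mem n l hl c hc c₂ hc₂) c' hc'

end PreBridge

/-! ### Composition with a bridge of Gentry type -/

namespace IsGentryType

variable {E₁ E : PKE} {H : HE} {f : PreBridge E₁ E} {g : PreBridge E H.toPKE}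

/-- Homomorphic decryption is correct for all keys and all ciphertexts. -/
theorem homomorphic_dec_correct (hH : H.IsFHE) (D : DecCircuit E H g.ι) :
    ∃ ν, Negligible ν ∧ ∀ n, ∀ sk ∈ (E.skGen n).support, ∀ skH ∈ (H.skGen n).support,
      ∀ pkH ∈ (H.pkGen n skH).support, ∀ c ∈ E.ct n, ∃ m, E.dec n sk c = PMF.pure m ∧
        1 - ν n ≤ prob ((H.encList n pkH ((D.skRep n sk).map (D.bit n))).bind fun v =>
          (H.encList n pkH ((D.ctRep n c).map (D.bit n))).bind fun cs =>
            (H.eval n pkH (D.circ n).encode (v.append cs)).bind (H.dec n skH)) (g.ι n m) := by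
  obtain ⟨p, hp⟩ := D.len_poly
  obtain ⟨q, hq⟩ := D.circ_polyTime.isPoly.size_le
  -- `p` bounds the number of inputs, and `q` the size of the circuit, which is the output of a
  -- polynomial time algorithm.
  obtain ⟨ν, hν, h⟩ := H.eval_correct (p + q)
  refine ⟨ν, hν, fun n sk hsk skH hskH pkH hpkH c hc => ?_⟩
  obtain ⟨m, hm, hC⟩ := D.circ_apply n sk hsk c hc
  refine ⟨m, hm, ?_⟩
  have hsize := hq n Data.nil (D.circ n).encode (by simp)
  have := h n skH hskH pkH hpkH _ _ (hH n _ _ (D.circ_isMap n)) (by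
    have := hp n
    simp only [Data.size, add_zero] at hsize
    rw [Polynomial.eval_add]
    omega) ((D.skRep n sk).map (D.bit n) ++ (D.ctRep n c).map (D.bit n))
    (by simp [D.skRep_length n sk hsk, D.ctRep_length n c hc])
    (by
      intro x hx
      rw [List.mem_append, List.mem_map, List.mem_map] at hx
      rcases hx with ⟨b, -, rfl⟩ | ⟨b, -, rfl⟩ <;> exact D.bit_mem n b)
  rw [hC] at this
  simpa only [PKE.encList_append, bind_eq, PMF.bind_bind, PMF.pure_bind] using this

/-- The last two stages of the key generation of `g ∘ f`, when `g` is of Gentry type. -/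
theorem keyGen_bind {D : DecCircuit E H g.ι} {n : ℕ}
    (hD : ∀ sk ∈ (E.skGen n).support,
      g.skStage n sk = (do let skH ← H.skGen n; pure (node skH Data.nil)) ∧
      ∀ pk ∈ (E.pkGen n sk).support, ∀ skH ∈ (H.skGen n).support,
        ∀ pkH ∈ (H.pkGen n skH).support, g.bkStage n sk pk skH pkH Data.nil =
          (do let v ← H.encList n pkH ((D.skRep n sk).map (D.bit n)); pure (node pkH v)))
    (hf : f.IsBridge) {α : Type} (F : BridgeKeys → PMF α) :
    ((g.comp f).keyGen n).bind F = (f.keyGen n).bind fun k => (H.skGen n).bind fun skH =>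
      (H.pkGen n skH).bind fun pkH =>
        (H.encList n pkH ((D.skRep n k.sk₂).map (D.bit n))).bind fun v =>
          F ⟨k.sk₁, k.pk₁, skH, pkH, node k.bk (node k.pk₂ (node pkH v))⟩ := by
  rw [PreBridge.keyGen_comp]
  simp only [bind_eq, pure_eq, PMF.bind_bind, PMF.pure_bind]
  refine bind_congr_support fun k hk => ?_
  obtain ⟨-, -, -, -, -, hpk, -⟩ := PreBridge.mem_support_keyGen.1 hk
  obtain ⟨h1, h2⟩ := hD k.sk₂ (hf.sk₂_mem hk)
  rw [h1]
  simp only [bind_eq, pure_eq, PMF.bind_bind, PMF.pure_bind, fst_node, snd_node]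
  refine bind_congr_support fun skH hskH => bind_congr_support fun pkH hpkH => ?_
  rw [h2 k.pk₂ hpk skH hskH pkH hpkH]
  simp only [bind_eq, pure_eq, PMF.bind_bind, PMF.pure_bind]

/-- Condition on a run in which `f` delivers a ciphertext that decrypts to `f.ι n m`: whatever keys
and ciphertext occurred, homomorphic decryption then succeeds with probability at least `1 - ν n`.
-/
theorem comp_correct (hH : H.IsFHE) (hf : f.IsBridge) (hg : IsGentryType g) :
    ∃ ν, Negligible ν ∧ ∀ n, ∀ m ∈ E₁.msg n, 1 - ν n ≤ prob (do
      let k ← (g.comp f).keyGen n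
      let c ← E₁.enc n k.pk₁ m
      let c' ← (g.comp f).apply n k.bk c
      H.dec n k.sk₂ c') ((g.comp f).ι n m) := by
  obtain ⟨-, D, hD⟩ := hg
  obtain ⟨μ, hμ, hμf⟩ := hf.correct
  obtain ⟨ν, hν, hνD⟩ := homomorphic_dec_correct hH D
  refine ⟨fun n => μ n + ν n, hμ.add hν, fun n m hm => ?_⟩
  have hf1 := hμf n m hm
  have key : ENNReal.ofReal (1 - ν n) * ((f.keyGen n).bind fun k => (E₁.enc n k.pk₁ m).bind
      fun c => (f.apply n k.bk c).bind fun c' => E.dec n k.sk₂ c') (f.ι n m) ≤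
      (((g.comp f).keyGen n).bind fun k => (E₁.enc n k.pk₁ m).bind fun c =>
        ((g.comp f).apply n k.bk c).bind fun c' => H.dec n k.sk₂ c') (g.ι n (f.ι n m)) := by
    rw [keyGen_bind (fun sk hsk => ⟨(hD n sk hsk).1, fun pk hpk skH hskH pkH hpkH =>
      ((hD n sk hsk).2 pk hpk skH hskH pkH hpkH).1⟩) hf]
    refine mul_bind_apply_le fun k hk => le_bind_apply fun skH hskH =>
      le_bind_apply fun pkH hpkH => ?_
    obtain ⟨h1, h2, -, -, -, hpk, -⟩ := PreBridge.mem_support_keyGen.1 hk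
    simp only [PreBridge.comp, bind_eq, PMF.bind_bind, fst_node, snd_node]
    -- The encrypted key bits do not influence the ciphertexts of `E₁` and `E`, so they may be drawn
    -- last, for a fixed ciphertext `c₂`.
    rw [← bind_comm₂]
    refine mul_bind_apply_le fun c hc => mul_bind_apply_le fun c₂ hc₂ => ?_
    have hc2 := hf.apply_mem n k hk c (E₁.enc_mem n _ h1 _ h2 m hm c hc) c₂ hc₂
    obtain ⟨m', hm', hle⟩ := hνD n k.sk₂ (hf.sk₂_mem hk) skH hskH pkH hpkH c₂ hc2
    have e := bind_congr_support (p := H.encList n pkH ((D.skRep n k.sk₂).map (D.bit n)))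
      (F := fun v => (g.apply n (node pkH v) c₂).bind (H.dec n skH)) fun v hv => by
        rw [((hD n k.sk₂ (hf.sk₂_mem hk)).2 k.pk₂ hpk skH hskH pkH hpkH).2 v hv c₂ hc2, bind_eq,
          PMF.bind_bind]
    rw [e, hm']
    -- Decryption of `c₂` is certain: a wrong value contributes zero on the left, and the right
    -- value contributes the factor `1`.
    by_cases hmm : m' = f.ι n m
    · rw [← hmm, PMF.pure_apply_self, mul_one]
      exact ENNReal.ofReal_le_of_le_toReal hle
    · rw [PMF.pure_apply_of_ne _ _ (Ne.symm hmm), mul_zero]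
      exact zero_le
  have key' := ENNReal.toReal_mono (PMF.apply_ne_top _ _) key
  rw [ENNReal.toReal_mul, ENNReal.toReal_ofReal'] at key'
  refine le_trans ?_ key'
  have hP1 := prob_le_one ((f.keyGen n).bind fun k => (E₁.enc n k.pk₁ m).bind
      fun c => (f.apply n k.bk c).bind fun c' => E.dec n k.sk₂ c') (f.ι n m)
  have hP0 := prob_nonneg ((f.keyGen n).bind fun k => (E₁.enc n k.pk₁ m).bind
      fun c => (f.apply n k.bk c).bind fun c' => E.dec n k.sk₂ c') (f.ι n m)
  simp only [bind_eq] at hf1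
  -- `ν n` may exceed `1`, in which case `ENNReal.ofReal` truncates; hence the maximum with `0`.
  change _ ≤ max (1 - ν n) 0 * prob _ _
  have hν0 := hν.1 n
  have h3 := mul_le_mul_of_nonneg_right (le_max_left (1 - ν n) 0) hP0
  nlinarith

theorem comp_isBridge (hH : H.IsFHE) (hf : f.IsBridge) (hg : IsGentryType g) :
    (g.comp f).IsBridge where
  ι_polyTime := hg.1.ι_polyTime.comp hf.ι_polyTime
  ι_mem n m hm := hg.1.ι_mem n _ (hf.ι_mem n m hm)
  skStage_ppt := PreBridge.comp_skStage_ppt hf hg.1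
  skStage_mem := PreBridge.comp_skStage_mem hf hg.1
  bkStage_ppt := PreBridge.comp_bkStage_ppt hf hg.1
  apply_ppt := PreBridge.comp_apply_ppt hf hg.1
  apply_mem := PreBridge.comp_apply_mem hf hg.1
  correct := comp_correct hH hf hg

/-! ### Security: replacing the encrypted secret key -/

/-- The public information of `g ∘ f`, from `(pk₁, pk₂, bk)` and `(pkH, v)`. -/
def publicInfo (z k : Data) : Data :=
  node z.fst (node k.fst (node z.snd.snd (node z.snd.fst (node k.fst k.snd))))

theorem isPoly_publicInfo {F G : ℕ → Data → Data} (hF : IsPoly F) (hG : IsPoly G) :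
    IsPoly fun n x => publicInfo (F n x) (G n x) :=
  hF.fst.node (hG.fst.node (hF.snd.snd.node (hF.snd.fst.node (hG.fst.node hG.snd))))

/-- Keys of `f`, along with the bits of the secret key `sk₂` and of an independent one. -/
def sampleKeys (f : PreBridge E₁ E) (D : DecCircuit E H g.ι) (n : ℕ) : PMF Data :=
  (f.keyGen n).bind fun k => (E.skGen n).bind fun sk =>
    PMF.pure (node (ofBits (D.skRep n sk)) (node (ofBits (D.skRep n k.sk₂))
      (node k.pk₁ (node k.pk₂ k.bk))))

theorem isPPT_sampleKeys (hf : f.IsBridge) (D : DecCircuit E H g.ι) :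
    IsPPT fun n _ => sampleKeys f D n := by
  have i : IsPoly fun _ x => x.fst := IsPoly.id.fst
  simp only [sampleKeys, PreBridge.keyGen, bind_eq, pure_eq, PMF.bind_bind, PMF.pure_bind]
  refine IsPPT.bind' E₁.skGen_ppt (IsPPT.bind' (E₁.pkGen_ppt.subst IsPoly.id.snd) (IsPPT.bind'
    (hf.skStage_ppt.subst i.snd) (IsPPT.bind' (E.pkGen_ppt.subst IsPoly.id.snd.fst) (IsPPT.bind'
      (hf.bkStage_ppt.subst (F := fun _ x => node x.fst.fst.fst.snd (node x.fst.fst.snd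
        (node x.fst.snd.fst (node x.snd x.fst.snd.snd)))) (i.fst.fst.snd.node (i.fst.snd.node
          (i.snd.fst.node (IsPoly.id.snd.node i.snd.snd)))))
      (IsPPT.bind' (E.skGen_ppt.subst IsPoly.nil) ?_)))))
  exact (D.skRep_polyTime.isPoly.subst IsPoly.id.snd).node
    ((D.skRep_polyTime.isPoly.subst i.fst.fst.snd.fst).node
      (i.fst.fst.fst.snd.node (i.fst.snd.node i.snd)))

/-- The reduction to the security of `f`: the secret key of `E` in the Gentry type bridge key is
replaced by an independent one. -/
def simulator (D : DecCircuit E H g.ι) (A : Adversary) : Adversary where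
  choose n z := (H.skGen n).bind fun skH => (H.pkGen n skH).bind fun pkH =>
    (E.skGen n).bind fun sk => (H.encBits D.bit n pkH (ofBits (D.skRep n sk))).bind fun v =>
      A.choose n (publicInfo z (node pkH v))
  guess := A.guess
  choose_ppt := by
    have i : IsPoly fun _ x => x.fst := IsPoly.id.fst
    refine IsPPT.bind' (H.skGen_ppt.subst IsPoly.nil) (IsPPT.bind'
      (H.pkGen_ppt.subst IsPoly.id.snd) (IsPPT.bind' (E.skGen_ppt.subst IsPoly.nil) (IsPPT.bind'
        ((H.isPPT_encBits D.bit_polyTime).subst (F := fun n x => node x.fst.snd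
          (ofBits (D.skRep n x.snd))) (i.snd.node (D.skRep_polyTime.isPoly.subst IsPoly.id.snd)))
        (A.choose_ppt.subst ?_))))
    exact isPoly_publicInfo i.fst.fst.fst (i.fst.snd.node IsPoly.id.snd)
  guess_ppt := A.guess_ppt

/-- The rest of the experiment for `g ∘ f`, as a distinguisher for the encryptions in the bridge
key. -/
def bridgeKeyDistinguisher (E₁ : PKE) (A : Adversary) (n : ℕ) (y : Data) : PMF Data :=
  (E₁.guessGame A n y.fst.fst (publicInfo y.fst y.snd)).map ofBit

theorem isPPT_bridgeKeyDistinguisher (A : Adversary) : IsPPT (bridgeKeyDistinguisher E₁ A) :=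
  (E₁.isPPT_guessGame A).subst (F := fun _ y => node y.fst.fst (publicInfo y.fst y.snd))
    (IsPoly.id.fst.fst.node (isPoly_publicInfo IsPoly.id.fst IsPoly.id.snd))

theorem distinguish_eq (E₁ : PKE) (H : HE) (bit : ℕ → Bool → Data) (A : Adversary) (n : ℕ)
    (pkH st : Data) (l : List Bool) :
    H.distinguish bit (bridgeKeyDistinguisher E₁ A) n pkH st (ofBits l).toList =
      (H.encList n pkH (l.map (bit n))).bind fun v =>
        E₁.guessGame A n st.fst (publicInfo st (node pkH v)) := by
  simp only [PKE.distinguish, bridgeKeyDistinguisher, ofBits, Data.toList_ofList, List.map_map,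
    Function.comp_def, Data.toBit_ofBit, fst_node, snd_node, PMF.bind_map, PMF.bind_pure]

/-- Triangle inequality through the game with an independent key in the bridge key: `h1` bounds the
change of the success probability by security of `H`, and `h2` the remaining advantage by security
of `f`. -/
theorem comp_secure (hHs : H.toPKE.Secure) (hf : f.IsBridge) (hfs : f.Secure)
    (hg : IsGentryType g) : (g.comp f).Secure := by
  obtain ⟨-, D, hD⟩ := hg
  obtain ⟨p, hp⟩ := D.len_poly
  intro A hA
  have hS : (simulator D A).ValidFor E₁.msg := by
    intro n z r hr
    simp only [simulator, PMF.mem_support_bind_iff] at hr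
    obtain ⟨skH, -, pkH, -, sk, -, v, -, hr⟩ := hr
    exact hA n _ r hr
  have h1 := hHs.distinguish_negligible D.bit_polyTime D.bit_mem (isPPT_sampleKeys hf D)
    (L := D.skLen) (fun n s hs => by
      simp only [sampleKeys, PMF.mem_support_bind_iff, PMF.support_pure,
        Set.mem_singleton_iff] at hs
      obtain ⟨k, hk, sk, hsk, rfl⟩ := hs
      simp only [fst_node, snd_node, ofBits, Data.toList_ofList, List.length_map]
      exact ⟨D.skRep_length n sk hsk, D.skRep_length n _ (hf.sk₂_mem hk)⟩)
    (fun n => (Nat.le_add_right _ _).trans (hp n)) (isPPT_bridgeKeyDistinguisher (E₁ := E₁) A)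
  have h2 := hfs (simulator D A) hS
  refine Negligible.of_le_mul (h1.add h2) 2 (fun n => abs_nonneg _) fun n => ?_
  -- With the true bits of `sk₂` the distinguisher plays the actual experiment; the independent key
  -- is sampled but never used, and `PMF.bind_const` removes it.
  have e1 : ((H.skGen n).bind fun sk => (H.pkGen n sk).bind fun pk => (sampleKeys f D n).bind
      fun s => H.distinguish D.bit (bridgeKeyDistinguisher E₁ A) n pk s.snd.snd
        s.snd.fst.toList) = E₁.experiment (fun n => do
          let k ← (g.comp f).keyGen n
          pure (k.pk₁, node k.pk₁ (node k.pk₂ k.bk))) A n := by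
    rw [PKE.experiment_eq]
    simp only [bind_eq, pure_eq, PMF.bind_bind, PMF.pure_bind]
    rw [keyGen_bind (fun sk hsk => ⟨(hD n sk hsk).1, fun pk hpk skH hskH pkH hpkH =>
      ((hD n sk hsk).2 pk hpk skH hskH pkH hpkH).1⟩) hf, ← bind_comm₂]
    simp only [sampleKeys, PMF.bind_bind, PMF.pure_bind, fst_node, snd_node, distinguish_eq,
      PMF.bind_const, publicInfo]
  -- With the independent key the encrypted bits no longer involve `sk₂`. The game is that of the
  -- simulator, which samples the keys of `H` after those of `f` instead of before.
  have e2 : ((H.skGen n).bind fun sk => (H.pkGen n sk).bind fun pk => (sampleKeys f D n).bind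
      fun s => H.distinguish D.bit (bridgeKeyDistinguisher E₁ A) n pk s.snd.snd
        s.fst.toList) = E₁.experiment (fun n => do
          let k ← f.keyGen n
          pure (k.pk₁, node k.pk₁ (node k.pk₂ k.bk))) (simulator D A) n := by
    rw [PKE.experiment_eq]
    simp only [bind_eq, pure_eq, PMF.bind_bind, PMF.pure_bind, PKE.guessGame, simulator,
      sampleKeys, fst_node, snd_node, distinguish_eq, PKE.encBits, Data.toBits_ofBits]
    exact bind_comm₂ _ _ _ _
  rw [e1, e2]
  -- A success probability `x` means the advantage `2 * x - 1`, so a change of `x` counts twice;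
  -- hence the factor `2`.
  simp only [prob_true_sub_false, Polynomial.eval_ofNat, Nat.cast_ofNat]
  generalize prob (E₁.experiment _ A n) true = x
  generalize prob (E₁.experiment _ (simulator D A) n) true = y
  have h3 := abs_add_le (2 * (x - y)) (2 * y - 1)
  rw [abs_mul, abs_two, show 2 * (x - y) + (2 * y - 1) = 2 * x - 1 by ring] at h3
  have := abs_nonneg (2 * y - 1)
  linarith

end IsGentryType

end Crypto

end

theorem theorem4 (E₁ E₂ : Crypto.PKE) (H : Crypto.HE) (hH : H.IsFHE) (hHs : H.toPKE.Secure)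
    (f : Crypto.PreBridge E₁ E₂) (hf : f.IsBridge) (hfs : f.Secure)
    (g : Crypto.PreBridge E₂ H.toPKE) (hg : Crypto.IsGentryType g) (hgs : g.Secure) :
    (g.comp f).IsBridge ∧ (g.comp f).Secure :=
  ⟨hg.comp_isBridge hH hf, hg.comp_secure hHs hf hfs⟩
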